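/- Let $\mathbb T=\mathbb R/\mathbb Z$, $e_n(x)=e^{2\pi i n x}$ and $\langle n\rangle=(1+n^2)^{1/2}$ for $n\in\mathbb Z$. For $s\in\mathbb R$ and $1\le p<\infty$, let $\mathcal FL^{s,p}(\mathbb T)$ be the space of distributions $u$ on $\mathbb T$ with $$\|u\|_{\mathcal FL^{s,p}}=\big\|\langle n\rangle^s\,\widehat u(n)\big\|_{\ell^p_n(\mathbb Z)}<\infty ,$$ and let $\gamma(L^2;\mathcal FL^{s,p})$ be the set of bounded linear operators $\phi:L^2(\mathbb T)\to\mathcal FL^{s,p}(\mathbb T)$ with $$\|\phi\|_{\gamma(L^2;\mathcal FL^{s,p})}=\Big\|\Big(\sum_{k\in\mathbb Z}\big|\langle n\rangle^s\,\widehat{\phi(e_k)}(n)\big|^2\Big)^{1/2}\Big\|_{\ell^p_n(\mathbb Z)}<\infty .$$ Let $(\beta_k)_{k\in\mathbb Z}$ be mutually independent standard complex Brownian motions on a probability space (normalized by $\mathbb E|\beta_k(t)|^2=t$), let $W(t)=\sum_{k}\beta_k(t)e_k$ be the associated cylindrical Wiener process on $L^2(\mathbb T)$, and let $S(t)=e^{-it\partial_x^2}$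 be the linear Schrödinger propagator. The stochastic convolution is $$\Psi(t)=\int_0^t S(t-t')\,\phi\,dW(t')=\sum_{k\in\mathbb Z}\int_0^t S(t-t')\phi(e_k)\,d\beta_k(t'),\qquad t\ge 0,$$ where the Wiener integrals and the sum over $k$ (which converges in $L^2(\Omega)$) are taken for each Fourier coefficient. **Lemma 3.3.** Let $s\in\mathbb R$, $1\le p<\infty$ and $\phi\in\gamma(L^2;\mathcal FL^{s,p})$. Then the stochastic convolution $\Psi$ exists as an $\mathcal FL^{s,p}(\mathbb T)$-valued process, for each $t\ge0$ the random variable $\Psi(t)$ is determined up to almost sure equality, and $\Psi$ (in a suitable version) belongs to $C(\mathbb R_+;\mathcal FL^{s,p}(\mathbb T))$ almost surely. -/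

import Mathlib

open MeasureTheory ProbabilityTheory Filter Topology
open scoped ENNReal NNReal

noncomputable section

namespace FourierLebesgue

/-! ### Distributions on the torus `𝕋 = ℝ / ℤ` -/

/-- The space `C^∞(𝕋)` of smooth functions on `𝕋 = ℝ / ℤ`. -/
def TestFunction : Submodule ℂ (UnitAddCircle → ℂ) where
  carrier := {f | ContDiff ℝ (⊤ : ℕ∞) (fun x : ℝ => f (x : UnitAddCircle))}
  add_mem' {f g} hf hg := by
    have hf' : ContDiff ℝ (⊤ : ℕ∞) (fun x : ℝ => f (x : UnitAddCircle)) := hf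
    have hg' : ContDiff ℝ (⊤ : ℕ∞) (fun x : ℝ => g (x : UnitAddCircle)) := hg
    exact hf'.add hg'
  zero_mem' := by
    change ContDiff ℝ (⊤ : ℕ∞) (fun _ : ℝ => (0 : ℂ))
    exact contDiff_const
  smul_mem' c f hf := by
    have hf' : ContDiff ℝ (⊤ : ℕ∞) (fun x : ℝ => f (x : UnitAddCircle)) := hf
    change ContDiff ℝ (⊤ : ℕ∞) (fun x : ℝ => c * f (x : UnitAddCircle))
    exact contDiff_const.mul hf'

/-- A test function, viewed as a `1`-periodic function on the line. -/
def onLine (f : TestFunction) (x : ℝ) : ℂ := (f : UnitAddCircle → ℂ) (x : UnitAddCircle)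

/-- The space `𝓓'(𝕋)` of distributions: the linear functionals `u` on `C^∞(𝕋)` that are continuous,
i.e. `|u(f)| ≤ C max_{j ≤ N} sup_x |f^{(j)}(x)|` for some `C` and `N`. -/
def Distribution : Submodule ℂ (Module.Dual ℂ TestFunction) where
  carrier := {u | ∃ (C : ℝ) (N : ℕ), ∀ (f : TestFunction) (M : ℝ),
    (∀ j ≤ N, ∀ x : ℝ, ‖iteratedDeriv j (onLine f) x‖ ≤ M) → ‖u f‖ ≤ C * M}
  add_mem' := by
    rintro u v ⟨C, N, h⟩ ⟨C', N', h'⟩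
    refine ⟨C + C', max N N', fun f M hM => ?_⟩
    have h1 := h f M fun j hj => hM j (hj.trans (le_max_left _ _))
    have h2 := h' f M fun j hj => hM j (hj.trans (le_max_right _ _))
    calc ‖(u + v) f‖ ≤ ‖u f‖ + ‖v f‖ := norm_add_le _ _
      _ ≤ (C + C') * M := by linarith
  zero_mem' := ⟨0, 0, fun f M _ => by simp⟩
  smul_mem' := by
    rintro c u ⟨C, N, h⟩
    refine ⟨‖c‖ * C, N, fun f M hM => ?_⟩
    rw [LinearMap.smul_apply, norm_smul, mul_assoc]
    exact mul_le_mul_of_nonneg_left (h f M hM) (norm_nonneg c)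

lemma Distribution.exists_bound (u : Distribution) : ∃ (C : ℝ) (N : ℕ),
    ∀ (f : TestFunction) (M : ℝ), (∀ j ≤ N, ∀ x : ℝ, ‖iteratedDeriv j (onLine f) x‖ ≤ M) →
      ‖(u : Module.Dual ℂ TestFunction) f‖ ≤ C * M := u.2

/-- The character `e_n(x) = e^{2πinx}` as a test function. -/
def character (n : ℤ) : TestFunction :=
  ⟨fun x => fourier n x, by
    change ContDiff ℝ (⊤ : ℕ∞) (fun x : ℝ => fourier n (x : UnitAddCircle))
    simp only [fourier_coe_apply]
    have h : ContDiff ℝ (⊤ : ℕ∞) (fun x : ℝ => (x : ℂ)) := Complex.ofRealCLM.contDiff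
    fun_prop⟩

/-- The Fourier coefficient `û(n) = u(e_{-n})` of a distribution `u`. -/
def coeff (u : Distribution) (n : ℤ) : ℂ := (u : Module.Dual ℂ TestFunction) (character (-n))

/-! ### Basic facts on Fourier coefficients of test functions and distributions -/

lemma onLine_contDiff (f : TestFunction) : ContDiff ℝ (⊤ : ℕ∞) (onLine f) := f.2

lemma iteratedDeriv_periodic (f : TestFunction) (j : ℕ) :
    Function.Periodic (iteratedDeriv j (onLine f)) 1 := by
  intro x
  have h : (fun y : ℝ => (onLine f) (y + 1)) = (onLine f) := by
    funext y
    simp [onLine]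
  have h2 := congrFun (iteratedDeriv_comp_add_const j (onLine f) 1) x
  rw [h] at h2
  exact h2.symm

/-- The `j`-th derivative of a test function, as a continuous function on the torus. -/
def derivC (f : TestFunction) (j : ℕ) : C(UnitAddCircle, ℂ) where
  toFun := (iteratedDeriv_periodic f j).lift
  continuous_toFun := continuous_coinduced_dom.mpr
    ((onLine_contDiff f).continuous_iteratedDeriv j (by exact_mod_cast le_top))

lemma derivC_coe (f : TestFunction) (j : ℕ) (x : ℝ) :
    derivC f j (x : UnitAddCircle) = iteratedDeriv j (onLine f) x := rfl

lemma derivC_zero (f : TestFunction) :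
    (derivC f 0 : UnitAddCircle → ℂ) = (f : UnitAddCircle → ℂ) := by
  funext x
  induction x using QuotientAddGroup.induction_on with
  | H x => exact (derivC_coe f 0 x).trans (by simp [onLine])

lemma fourierCoeff_derivC_succ (f : TestFunction) (j : ℕ) (n : ℤ) :
    fourierCoeff (derivC f (j + 1)) n
      = (2 * Real.pi * Complex.I * n) * fourierCoeff (derivC f j) n := by
  rw [fourierCoeff_eq_intervalIntegral _ n 0, fourierCoeff_eq_intervalIntegral _ n 0]
  simp only [derivC_coe, smul_eq_mul, zero_add, one_div, inv_one, one_smul]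
  have hd : ∀ x : ℝ, HasDerivAt (iteratedDeriv j (onLine f)) (iteratedDeriv (j + 1) (onLine f) x) x := by
    intro x
    rw [iteratedDeriv_succ]
    exact (((onLine_contDiff f).differentiable_iteratedDeriv j
      (by exact_mod_cast WithTop.coe_lt_top _)) x).hasDerivAt
  have hc : ∀ i : ℕ, Continuous (iteratedDeriv i (onLine f)) := fun i =>
    (onLine_contDiff f).continuous_iteratedDeriv i (by exact_mod_cast le_top)
  have hF : Continuous fun x : ℝ => fourier (-n) (x : UnitAddCircle) :=
    (map_continuous (fourier (-n))).comp (AddCircle.continuous_mk' 1)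
  have hparts := intervalIntegral.integral_mul_deriv_eq_deriv_mul
    (a := 0) (b := 1) (u := fun x : ℝ => fourier (-n) (x : UnitAddCircle))
    (v := iteratedDeriv j (onLine f))
    (fun x _ => hasDerivAt_fourier_neg 1 n x) (fun x _ => hd x)
    ((hF.const_mul _).intervalIntegrable _ _) ((hc (j + 1)).intervalIntegrable _ _)
  have hp : iteratedDeriv j (onLine f) 1 = iteratedDeriv j (onLine f) 0 := by
    simpa using iteratedDeriv_periodic f j 0
  have he : ((1 : ℝ) : UnitAddCircle) = ((0 : ℝ) : UnitAddCircle) := by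
    simp
  rw [hparts, hp, he, sub_self, zero_sub, ← intervalIntegral.integral_const_mul,
    ← intervalIntegral.integral_neg]
  refine intervalIntegral.integral_congr fun x _ => ?_
  simp only [Complex.ofReal_one, div_one]
  ring

lemma fourierCoeff_derivC (f : TestFunction) (j : ℕ) (n : ℤ) :
    fourierCoeff (derivC f j) n
      = (2 * Real.pi * Complex.I * n) ^ j * fourierCoeff (f : UnitAddCircle → ℂ) n := by
  induction j with
  | zero => rw [derivC_zero]; simp
  | succ j ih => rw [fourierCoeff_derivC_succ, ih, pow_succ']; ring

lemma norm_fourierCoeff_le {g : UnitAddCircle → ℂ} {M : ℝ} (hg : ∀ x : ℝ, ‖g x‖ ≤ M) (n : ℤ) :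
    ‖fourierCoeff g n‖ ≤ M := by
  rw [fourierCoeff_eq_intervalIntegral _ n 0]
  have := intervalIntegral.norm_integral_le_of_norm_le_const (a := 0) (b := 0 + 1)
    (f := fun x : ℝ => fourier (-n) (x : UnitAddCircle) • g x) (C := M) (fun x _ => by
      rw [norm_smul, fourier_apply, Circle.norm_coe, one_mul]; exact hg x)
  simpa using this

/-- Rapid decay of the Fourier coefficients of a test function. -/
lemma pow_mul_norm_fourierCoeff_le (f : TestFunction) (N : ℕ) (M : ℝ)
    (hM : ∀ j ≤ N, ∀ x : ℝ, ‖iteratedDeriv j (onLine f) x‖ ≤ M) (n : ℤ) :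
    (1 + |(n : ℝ)|) ^ N * ‖fourierCoeff (f : UnitAddCircle → ℂ) n‖ ≤ 2 ^ N * M := by
  have h0 : ‖fourierCoeff (f : UnitAddCircle → ℂ) n‖ ≤ M :=
    norm_fourierCoeff_le (fun x => by
      simpa [onLine] using hM 0 (Nat.zero_le _) x) n
  have hN : ‖fourierCoeff (derivC f N) n‖ ≤ M :=
    norm_fourierCoeff_le (fun x => hM N le_rfl x) n
  set a := ‖fourierCoeff (f : UnitAddCircle → ℂ) n‖
  have ha : 0 ≤ a := norm_nonneg _
  rcases eq_or_ne n 0 with rfl | hn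
  · have : (1 : ℝ) ≤ 2 ^ N := one_le_pow₀ (by norm_num)
    have hM0 : 0 ≤ M := ha.trans h0
    simp only [Int.cast_zero, abs_zero, add_zero, one_pow, one_mul]
    nlinarith
  · have h1 : (1 : ℝ) ≤ |(n : ℝ)| := by
      rw [← Int.cast_abs]; exact_mod_cast Int.one_le_abs hn
    have h2 : (1 + |(n : ℝ)|) ^ N ≤ 2 ^ N * |(n : ℝ)| ^ N := by
      rw [← mul_pow]; exact pow_le_pow_left₀ (by positivity) (by linarith) N
    have h3 : |(n : ℝ)| ^ N * a ≤ M := by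
      rw [fourierCoeff_derivC, norm_mul, norm_pow] at hN
      refine le_trans (mul_le_mul_of_nonneg_right (pow_le_pow_left₀ (by positivity) ?_ N) ha) hN
      have : ‖(2 * Real.pi * Complex.I * n : ℂ)‖ = 2 * Real.pi * |(n : ℝ)| := by
        simp [abs_of_pos Real.pi_pos]
      rw [this]
      nlinarith [Real.pi_gt_three]
    calc (1 + |(n : ℝ)|) ^ N * a ≤ 2 ^ N * |(n : ℝ)| ^ N * a := by gcongr
      _ = 2 ^ N * (|(n : ℝ)| ^ N * a) := by ring
      _ ≤ 2 ^ N * M := by gcongr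

/-- The derivatives of a test function up to a given order are bounded. -/
lemma exists_deriv_bound (f : TestFunction) (N : ℕ) :
    ∃ M : ℝ, ∀ j ≤ N, ∀ x : ℝ, ‖iteratedDeriv j (onLine f) x‖ ≤ M := by
  refine ⟨∑ j ∈ Finset.range (N + 1), ‖derivC f j‖, fun j hj x => ?_⟩
  calc ‖iteratedDeriv j (onLine f) x‖ = ‖derivC f j (x : UnitAddCircle)‖ := rfl
    _ ≤ ‖derivC f j‖ := (derivC f j).norm_coe_le_norm _
    _ ≤ _ := Finset.single_le_sum (f := fun j => ‖derivC f j‖) (fun i _ => norm_nonneg _)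
      (Finset.mem_range.mpr (by omega))

lemma summable_inv_sq : Summable fun n : ℤ => ((1 + |(n : ℝ)|) ^ 2)⁻¹ := by
  have h : Summable fun n : ℤ => |(n : ℝ)| ^ (-2 : ℝ) := Real.summable_abs_int_rpow (by norm_num)
  refine Summable.of_norm_bounded_eventually h ?_
  have : ∀ᶠ n : ℤ in cofinite, n ≠ 0 := (Set.finite_singleton (0 : ℤ)).compl_mem_cofinite
  filter_upwards [this] with n hn
  have h1 : (0 : ℝ) < |(n : ℝ)| := by positivity
  rw [Real.norm_of_nonneg (by positivity), Real.rpow_neg h1.le]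
  norm_num
  rw [← sq_abs (n : ℝ)]
  gcongr
  linarith

/-- Polynomial growth of a sequence indexed by the frequencies. -/
def PolyGrowth (a : ℤ → ℂ) : Prop := ∃ (C : ℝ) (N : ℕ), ∀ n, ‖a n‖ ≤ C * (1 + |(n : ℝ)|) ^ N

lemma norm_mul_fourierCoeff_le {a : ℤ → ℂ} {C : ℝ} {N : ℕ}
    (ha : ∀ n, ‖a n‖ ≤ C * (1 + |(n : ℝ)|) ^ N) (f : TestFunction) (M : ℝ)
    (hM : ∀ j ≤ N + 2, ∀ x : ℝ, ‖iteratedDeriv j (onLine f) x‖ ≤ M) (n : ℤ) :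
    ‖a n * fourierCoeff (f : UnitAddCircle → ℂ) (-n)‖
      ≤ C * 2 ^ (N + 2) * M * ((1 + |(n : ℝ)|) ^ 2)⁻¹ := by
  have h := pow_mul_norm_fourierCoeff_le f (N + 2) M hM (-n)
  have hC : 0 ≤ C := by simpa using (norm_nonneg _).trans (ha 0)
  rw [Int.cast_neg, abs_neg, pow_add] at h
  rw [norm_mul, ← div_eq_mul_inv, le_div_iff₀ (by positivity)]
  calc _ ≤ C * (1 + |(n : ℝ)|) ^ N * ‖fourierCoeff (f : UnitAddCircle → ℂ) (-n)‖
          * (1 + |(n : ℝ)|) ^ 2 := by gcongr; exact ha n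
    _ = C * ((1 + |(n : ℝ)|) ^ N * (1 + |(n : ℝ)|) ^ 2
          * ‖fourierCoeff (f : UnitAddCircle → ℂ) (-n)‖) := by ring
    _ ≤ C * (2 ^ (N + 2) * M) := by gcongr
    _ = _ := by ring

lemma summable_mul_fourierCoeff {a : ℤ → ℂ} (ha : PolyGrowth a) (f : TestFunction) :
    Summable fun n => a n * fourierCoeff (f : UnitAddCircle → ℂ) (-n) := by
  obtain ⟨C, N, h⟩ := ha
  obtain ⟨M, hM⟩ := exists_deriv_bound f (N + 2)
  exact Summable.of_norm_bounded (summable_inv_sq.mul_left _) (norm_mul_fourierCoeff_le h f M hM)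

lemma testFunction_integrable (f : TestFunction) :
    Integrable (f : UnitAddCircle → ℂ) AddCircle.haarAddCircle := by
  rw [← derivC_zero f]
  exact (derivC f 0).continuous.integrable_of_hasCompactSupport
    (HasCompactSupport.of_compactSpace _)

/-- The distribution `∑_n a_n e_n`, for a sequence `a` of polynomial growth. -/
def ofCoeff (a : ℤ → ℂ) (ha : PolyGrowth a) : Distribution :=
  ⟨{ toFun := fun f => ∑' n : ℤ, a n * fourierCoeff (f : UnitAddCircle → ℂ) (-n)
     map_add' := fun f g => by
      rw [← (summable_mul_fourierCoeff ha f).tsum_add (summable_mul_fourierCoeff ha g)]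
      refine tsum_congr fun n => ?_
      rw [Submodule.coe_add, fourierCoeff.add (testFunction_integrable f) (testFunction_integrable g), Pi.add_apply]
      ring
     map_smul' := fun c f => by
      rw [RingHom.id_apply, smul_eq_mul, ← tsum_mul_left]
      refine tsum_congr fun n => ?_
      rw [Submodule.coe_smul, fourierCoeff.const_smul, smul_eq_mul]
      ring }, by
    obtain ⟨C, N, h⟩ := ha
    refine ⟨C * 2 ^ (N + 2) * ∑' n : ℤ, ((1 + |(n : ℝ)|) ^ 2)⁻¹, N + 2, fun f M hM => ?_⟩
    have := tsum_of_norm_bounded ((summable_inv_sq.mul_left (C * 2 ^ (N + 2) * M)).hasSum)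
      (norm_mul_fourierCoeff_le h f M hM)
    rw [tsum_mul_left] at this
    refine this.trans (le_of_eq ?_)
    ring⟩

lemma coeff_ofCoeff (a : ℤ → ℂ) (ha : PolyGrowth a) (n : ℤ) : coeff (ofCoeff a ha) n = a n := by
  change ∑' m : ℤ, a m * fourierCoeff (fourier (-n) : C(UnitAddCircle, ℂ)) (-m) = a n
  rw [tsum_eq_single n]
  · rw [fourierCoeff_fourier]; simp
  · intro m hm
    rw [fourierCoeff_fourier, Pi.single_eq_of_ne (by simpa using hm), mul_zero]

lemma iteratedDeriv_character (n : ℤ) (j : ℕ) :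
    iteratedDeriv j (onLine (character n))
      = fun x : ℝ => (2 * Real.pi * Complex.I * n) ^ j * fourier n (x : UnitAddCircle) := by
  induction j with
  | zero => funext x; simp [character, onLine]
  | succ j ih =>
    funext x
    rw [iteratedDeriv_succ, ih]
    rw [deriv_const_mul _ (hasDerivAt_fourier 1 n x).differentiableAt,
      (hasDerivAt_fourier 1 n x).deriv, pow_succ]
    simp only [Complex.ofReal_one, div_one]
    ring

lemma coeff_polyGrowth (u : Distribution) : PolyGrowth (coeff u) := by
  obtain ⟨C, N, h⟩ := Distribution.exists_bound u
  refine ⟨|C| * (2 * Real.pi) ^ N, N, fun n => ?_⟩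
  have h1 := h (character (-n)) (((2 * Real.pi) * (1 + |(n : ℝ)|)) ^ N) (fun j hj x => by
    rw [iteratedDeriv_character, norm_mul, fourier_apply, Circle.norm_coe, mul_one, norm_pow]
    have e : ‖(2 * Real.pi * Complex.I * ((-n : ℤ) : ℂ))‖ = 2 * Real.pi * |(n : ℝ)| := by
      simp [abs_of_pos Real.pi_pos]
    rw [e]
    have hpi := Real.pi_gt_three
    have hn := abs_nonneg (n : ℝ)
    calc (2 * Real.pi * |(n : ℝ)|) ^ j ≤ (2 * Real.pi * (1 + |(n : ℝ)|)) ^ j := by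
          gcongr; linarith
      _ ≤ _ := pow_le_pow_right₀ (by nlinarith) hj)
  refine h1.trans ?_
  rw [mul_pow, ← mul_assoc]
  gcongr
  exact le_abs_self C

/-- A distribution is determined by its Fourier coefficients. -/
lemma coeff_injective {u : Distribution} (hu : ∀ n, coeff u n = 0) : u = 0 := by
  obtain ⟨C, N, h⟩ := Distribution.exists_bound u
  refine Subtype.ext (LinearMap.ext fun f => ?_)
  have hchar : ∀ n : ℤ, (u : Module.Dual ℂ TestFunction) (character n) = 0 := fun n => by
    simpa [coeff] using hu (-n)
  set c : ℕ → ℤ → ℂ := fun j n => fourierCoeff (derivC f j) n with hc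
  have hsum : ∀ j, Summable (c j) := fun j => by
    have hg : PolyGrowth fun n : ℤ => (2 * Real.pi * Complex.I * (-n : ℤ) : ℂ) ^ j := by
      refine ⟨(2 * Real.pi) ^ j, j, fun n => ?_⟩
      rw [norm_pow, ← mul_pow]
      have e : ‖(2 * Real.pi * Complex.I * ((-n : ℤ) : ℂ))‖ = 2 * Real.pi * |(n : ℝ)| := by
        simp [abs_of_pos Real.pi_pos]
      rw [e]
      have hpi := Real.pi_pos
      gcongr
      linarith
    have h1 := summable_mul_fourierCoeff hg f
    have h2 : (fun n : ℤ => (2 * Real.pi * Complex.I * (-n : ℤ) : ℂ) ^ j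
        * fourierCoeff (f : UnitAddCircle → ℂ) (-n)) = c j ∘ (Equiv.neg ℤ) := by
      funext n
      simp only [hc, Function.comp, Equiv.neg_apply]
      rw [fourierCoeff_derivC]
    rw [h2] at h1
    exact (Equiv.summable_iff _).mp h1
  -- the tails of the Fourier series
  let R : Finset ℤ → TestFunction := fun s =>
    f - ∑ n ∈ s, fourierCoeff (f : UnitAddCircle → ℂ) n • character n
  have hR : ∀ s, (u : Module.Dual ℂ TestFunction) (R s) = (u : Module.Dual ℂ TestFunction) f := by
    intro s
    simp [R, map_sub, map_sum, hchar]
  have hder : ∀ s j x, iteratedDeriv j (onLine (R s)) x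
      = derivC f j (x : UnitAddCircle) - ∑ n ∈ s, c j n • fourier n (x : UnitAddCircle) := by
    intro s j x
    have e1 : (onLine (R s)) = (onLine f)
        - ∑ n ∈ s, fun y => fourierCoeff (f : UnitAddCircle → ℂ) n * (onLine (character n)) y := by
      funext y
      simp [R, onLine, Finset.sum_apply]
    have hcd : ∀ g : TestFunction, ContDiffAt ℝ j (onLine g) x := fun g =>
      ((onLine_contDiff g).of_le (by exact_mod_cast le_top)).contDiffAt
    have hcd' : ∀ n ∈ s, ContDiffAt ℝ j
        (fun y => fourierCoeff (f : UnitAddCircle → ℂ) n * (onLine (character n)) y) x :=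
      fun n _ => contDiffAt_const.mul (hcd _)
    rw [e1, iteratedDeriv_sub (hcd f) (by
      have h3 := ContDiffAt.sum hcd'
      have e3 : (∑ n ∈ s, fun y => fourierCoeff (f : UnitAddCircle → ℂ) n * (onLine (character n)) y)
          = fun y => ∑ n ∈ s, fourierCoeff (f : UnitAddCircle → ℂ) n * (onLine (character n)) y := by
        funext y
        simp
      rw [e3]
      exact h3), derivC_coe, iteratedDeriv_sum hcd']
    congr 1
    refine Finset.sum_congr rfl fun n _ => ?_
    rw [iteratedDeriv_const_mul_field, iteratedDeriv_character]
    simp only [hc, fourierCoeff_derivC, smul_eq_mul]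
    ring
  have hlim : Tendsto (fun s : Finset ℤ => ∑ j ∈ Finset.range (N + 1),
      ‖derivC f j - ∑ n ∈ s, c j n • fourier n‖) atTop (𝓝 0) := by
    rw [← Finset.sum_const_zero (s := Finset.range (N + 1))]
    refine tendsto_finsetSum _ fun j _ => ?_
    have h1 : Tendsto (fun s : Finset ℤ => ∑ n ∈ s, c j n • fourier n) atTop (𝓝 (derivC f j)) :=
      hasSum_fourier_series_of_summable (hsum j)
    have h2 := ((tendsto_const_nhds (x := derivC f j)).sub h1).norm
    rwa [sub_self, norm_zero] at h2
  have hb : ∀ s : Finset ℤ, ‖(u : Module.Dual ℂ TestFunction) f‖ ≤ C *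
      ∑ j ∈ Finset.range (N + 1), ‖derivC f j - ∑ n ∈ s, c j n • fourier n‖ := by
    intro s
    rw [← hR s]
    refine h _ _ fun j hj x => ?_
    rw [hder]
    have h1 := (derivC f j - ∑ n ∈ s, c j n • fourier n).norm_coe_le_norm (x : UnitAddCircle)
    simp only [ContinuousMap.sub_apply, ContinuousMap.sum_apply, ContinuousMap.smul_apply] at h1
    exact h1.trans (Finset.single_le_sum
      (f := fun j => ‖derivC f j - ∑ n ∈ s, c j n • fourier n‖)
      (fun i _ => norm_nonneg _) (Finset.mem_range.mpr (by omega)))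
  have := ge_of_tendsto' (hlim.const_mul C) hb
  rw [mul_zero] at this
  simpa using this

/-! ### The Fourier-Lebesgue spaces -/

/-- The Japanese bracket `⟨n⟩ = (1 + n²)^{1/2}`. -/
def bracket (n : ℤ) : ℝ := Real.sqrt (1 + (n : ℝ) ^ 2)

lemma bracket_pos (n : ℤ) : 0 < bracket n := Real.sqrt_pos.mpr (by positivity)

/-- The weighted Fourier coefficients `⟨n⟩^s û(n)`. -/
def weightedCoeff (s : ℝ) (u : Distribution) (n : ℤ) : ℂ := ((bracket n ^ s : ℝ) : ℂ) * coeff u n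

lemma weightedCoeff_zero (s : ℝ) : weightedCoeff s 0 = 0 := by
  funext n; simp [weightedCoeff, coeff]

lemma weightedCoeff_add (s : ℝ) (u v : Distribution) :
    weightedCoeff s (u + v) = weightedCoeff s u + weightedCoeff s v := by
  funext n; simp [weightedCoeff, coeff, mul_add]

lemma weightedCoeff_smul (s : ℝ) (c : ℂ) (u : Distribution) :
    weightedCoeff s (c • u) = c • weightedCoeff s u := by
  funext n; simp [weightedCoeff, coeff]; ring

/-- The Fourier-Lebesgue space `𝓕L^{s,p}(𝕋)`: the distributions `u` on `𝕋` with
`‖⟨n⟩^s û(n)‖_{ℓ^p_n} < ∞`. -/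
def FL (s : ℝ) (p : ℝ≥0∞) : Submodule ℂ Distribution where
  carrier := {u | Memℓp (weightedCoeff s u) p}
  add_mem' {u v} hu hv := by
    rw [Set.mem_ofPred_eq, weightedCoeff_add]
    exact Memℓp.add hu hv
  zero_mem' := by
    rw [Set.mem_ofPred_eq, weightedCoeff_zero]
    exact zero_memℓp
  smul_mem' c u hu := by
    rw [Set.mem_ofPred_eq, weightedCoeff_smul]
    exact Memℓp.const_smul hu c

/-- The map `u ↦ (⟨n⟩^s û(n))_n` from `𝓕L^{s,p}(𝕋)` to `ℓ^p(ℤ)`. -/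
def weightedCoeffLp (s : ℝ) (p : ℝ≥0∞) : FL s p →ₗ[ℂ] lp (fun _ : ℤ => ℂ) p where
  toFun u := ⟨weightedCoeff s u, u.2⟩
  map_add' u v := Subtype.ext (weightedCoeff_add s u v)
  map_smul' c u := Subtype.ext (weightedCoeff_smul s c u)

lemma weightedCoeffLp_injective (s : ℝ) (p : ℝ≥0∞) :
    Function.Injective (weightedCoeffLp s p) := by
  intro u v huv
  refine Subtype.ext (sub_eq_zero.mp (coeff_injective fun n => ?_))
  have h : weightedCoeff s u n = weightedCoeff s v n := congrFun (congrArg Subtype.val huv) n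
  have h2 := mul_left_cancel₀
    (Complex.ofReal_ne_zero.mpr (Real.rpow_pos_of_pos (bracket_pos n) s).ne') h
  simpa [coeff, sub_eq_zero] using h2

/-- The norm `‖u‖_{𝓕L^{s,p}} = ‖⟨n⟩^s û(n)‖_{ℓ^p_n}`. -/
instance FL_normedAddCommGroup (s : ℝ) (p : ℝ≥0∞) [Fact (1 ≤ p)] :
    NormedAddCommGroup (FL s p) :=
  NormedAddCommGroup.induced (FL s p) (lp (fun _ : ℤ => ℂ) p) (weightedCoeffLp s p)
    (weightedCoeffLp_injective s p)

instance FL_normedSpace (s : ℝ) (p : ℝ≥0∞) [Fact (1 ≤ p)] : NormedSpace ℂ (FL s p) :=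
  NormedSpace.induced ℂ (FL s p) (lp (fun _ : ℤ => ℂ) p) (weightedCoeffLp s p)

/-! ### The Schrödinger propagator and γ-radonifying operators -/

/-- The symbol of `S(t) = e^{-it∂_x²}`; on the torus `ℝ / ℤ`, the symbol of `∂_x` is `2πin`. -/
def propagatorSymbol (t : ℝ) (n : ℤ) : ℂ :=
  Complex.exp (-Complex.I * t * (2 * Real.pi * Complex.I * n) ^ 2)

lemma norm_propagatorSymbol (t : ℝ) (n : ℤ) : ‖propagatorSymbol t n‖ = 1 := by
  have h : -Complex.I * t * (2 * Real.pi * Complex.I * n) ^ 2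
      = ((t * (2 * Real.pi * n) ^ 2 : ℝ) : ℂ) * Complex.I := by
    push_cast
    linear_combination (-Complex.I * t * (2 * Real.pi * n) ^ 2) * Complex.I_sq
  rw [propagatorSymbol, h, Complex.norm_exp_ofReal_mul_I]

lemma PolyGrowth.propagatorSymbol_mul {a : ℤ → ℂ} (ha : PolyGrowth a) (t : ℝ) :
    PolyGrowth fun n => propagatorSymbol t n * a n := by
  obtain ⟨C, N, h⟩ := ha
  exact ⟨C, N, fun n => by rw [norm_mul, norm_propagatorSymbol, one_mul]; exact h n⟩

/-- The linear Schrödinger propagator `S(t) = e^{-it∂_x²}` on distributions, i.e. the Fourier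
multiplier with symbol `e^{-it(2πin)²}`. -/
def propagator (t : ℝ) (u : Distribution) : Distribution :=
  ofCoeff (fun n => propagatorSymbol t n * coeff u n)
    ((coeff_polyGrowth u).propagatorSymbol_mul t)

lemma coeff_propagator (t : ℝ) (u : Distribution) (n : ℤ) :
    coeff (propagator t u) n = propagatorSymbol t n * coeff u n := coeff_ofCoeff _ _ n

/-- `L²(𝕋)`. -/
abbrev L2 : Type := Lp ℂ 2 (AddCircle.haarAddCircle (T := (1 : ℝ)))

/-- The orthonormal basis `e_k(x) = e^{2πikx}` of `L²(𝕋)`. -/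
def e (k : ℤ) : L2 := fourierLp 2 k

/-- The `γ(L²(𝕋); 𝓕L^{s,p}(𝕋))`-norm
`‖(∑_k |⟨n⟩^s (φ e_k)^(n)|²)^{1/2}‖_{ℓ^p_n}`, for `1 ≤ p < ∞`, with values in `[0, ∞]`. -/
def gammaNorm {s : ℝ} {p : ℝ≥0∞} [Fact (1 ≤ p)] (φ : L2 →L[ℂ] FL s p) : ℝ≥0∞ :=
  (∑' n : ℤ, ((∑' k : ℤ, ‖weightedCoeff s (φ (e k)) n‖ₑ ^ 2) ^ (1 / 2 : ℝ)) ^ p.toReal)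
    ^ (1 / p.toReal)

/-- `φ ∈ γ(L²(𝕋); 𝓕L^{s,p}(𝕋))`, for `1 ≤ p < ∞`. -/
def IsGammaRadonifying {s : ℝ} {p : ℝ≥0∞} [Fact (1 ≤ p)] (φ : L2 →L[ℂ] FL s p) : Prop :=
  gammaNorm φ < ∞

/-! ### The cylindrical Wiener process and the stochastic convolution -/

section Stochastic

variable {Ω : Type*} [MeasurableSpace Ω]

/-- A standard complex Brownian motion: `b = (B + iB') / √2` with independent standard real
Brownian motions `B` and `B'`, so that `𝔼|b(t)|² = t`. -/
structure IsComplexBrownian (b : ℝ≥0 → Ω → ℂ) (P : Measure Ω) : Prop where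
  re : IsBrownianReal (fun t ω => Real.sqrt 2 * (b t ω).re) P
  im : IsBrownianReal (fun t ω => Real.sqrt 2 * (b t ω).im) P
  indep : IndepFun (fun ω t => (b t ω).re) (fun ω t => (b t ω).im) P

/-- The family `β = (β_k)_{k ∈ ℤ}` consists of mutually independent complex Brownian motions, i.e.
it drives a cylindrical Wiener process `W(t) = ∑_k β_k(t) e_k` on `L²(𝕋)`. -/
structure IsCylindricalWiener (β : ℤ → ℝ≥0 → Ω → ℂ) (P : Measure Ω) : Prop where
  brownian : ∀ k, IsComplexBrownian (β k) P
  indep : iIndepFun (fun k ω t => β k t ω) P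

/-- A step function `∑_{j < size} val_j 1_{(pt_j, pt_{j+1}]}` on `[0, t]`. -/
structure StepFunction (t : ℝ≥0) where
  size : ℕ
  pt : ℕ → ℝ≥0
  val : ℕ → ℂ
  mono : Monotone pt
  le : ∀ j, pt j ≤ t

/-- The values of a step function. -/
def StepFunction.toFun {t : ℝ≥0} (h : StepFunction t) (r : ℝ) : ℂ :=
  ∑ j ∈ Finset.range h.size,
    (Set.Ioc (h.pt j : ℝ) (h.pt (j + 1) : ℝ)).indicator (fun _ => h.val j) r

/-- The elementary Wiener integral `∑_j val_j (b(pt_{j+1}) - b(pt_j))` of a step function. -/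
def StepFunction.integral {t : ℝ≥0} (h : StepFunction t) (b : ℝ≥0 → Ω → ℂ) (ω : Ω) : ℂ :=
  ∑ j ∈ Finset.range h.size, h.val j * (b (h.pt (j + 1)) ω - b (h.pt j) ω)

/-- `X` is (a version of) the Wiener integral `∫_0^t f(r) db(r)`: the `L²(Ω)`-limit of the
elementary integrals of step functions that converge to `f` in `L²([0, t])`. -/
def IsWienerIntegral (b : ℝ≥0 → Ω → ℂ) (P : Measure Ω) (t : ℝ≥0) (f : ℝ → ℂ) (X : Ω → ℂ) : Prop :=
  MemLp X 2 P ∧ ∃ h : ℕ → StepFunction t,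
    Tendsto (fun m => eLpNorm (fun r => (h m).toFun r - f r) 2
      (volume.restrict (Set.Ioc (0 : ℝ) t))) atTop (𝓝 0) ∧
    Tendsto (fun m => eLpNorm (fun ω => (h m).integral b ω - X ω) 2 P) atTop (𝓝 0)

/-- `Ψ` is (a version of) the stochastic convolution
`Ψ(t) = ∫_0^t S(t - r) φ dW(r) = ∑_k ∫_0^t S(t - r) φ(e_k) dβ_k(r)`: for every `t`, `Ψ(t)` is an
`𝓕L^{s,p}(𝕋)`-valued random variable, and its `n`-th Fourier coefficient is the sum over `k`,
convergent in `L²(Ω)`, of the Wiener integrals on `[0, t]` of the `n`-th Fourier coefficient of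
`r ↦ S(t - r) φ(e_k)` with respect to `β_k`. -/
def IsStochasticConvolution {s : ℝ} {p : ℝ≥0∞} [Fact (1 ≤ p)] (φ : L2 →L[ℂ] FL s p)
    (β : ℤ → ℝ≥0 → Ω → ℂ) (P : Measure Ω) (Ψ : ℝ≥0 → Ω → FL s p) : Prop :=
  ∀ t : ℝ≥0, AEStronglyMeasurable (Ψ t) P ∧ ∀ n : ℤ, ∃ I : ℤ → Ω → ℂ,
    (∀ k, IsWienerIntegral (β k) P t (fun r => coeff (propagator (t - r) (φ (e k))) n) (I k)) ∧
    Tendsto (fun F : Finset ℤ => eLpNorm (fun ω => ∑ k ∈ F, I k ω - coeff (Ψ t ω) n) 2 P)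
      atTop (𝓝 0)

end Stochastic

end FourierLebesgue

end

noncomputable section

namespace FourierLebesgue

/-! ### Families of vectors with the same Gram matrix -/

section Gram

variable {ι H H' : Type*} [NormedAddCommGroup H] [InnerProductSpace ℂ H]
  [NormedAddCommGroup H'] [InnerProductSpace ℂ H']

/-! Everything happens one Fourier mode at a time. With `a k = coeff (φ (e k)) n` and `σ` the symbol
of the propagator at `n`, the group law `σ(t - r) = σ(t) σ(-r)` makes the `n`-th coefficient of the
convolution equal to `σ(t) M(t)`, where `M(t) = ∑_k ∫_0^t σ(-r) a_k dβ_k(r)` has a `t`-independent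
integrand. Since `|σ| = 1`, the Itô isometry bounds the variance of `M(t) - M(s)` by `(t - s) E_n`
with `E_n = ∑_k |a_k|²` (`exists_modeProcess`). The increments lie in the first chaos, where the
moment of order `2m` is at most a constant times the `m`-th power of the variance
(`eLpNorm_le_of_mem_closure_chaosSpan`).

A quantitative Kolmogorov argument follows. A weighted sum of `2m`-th powers of dyadic increments,
`chainEnergy`, has expectation at most a constant times `E_n ^ m`, and its `2m`-th root `R_n`
controls both the supremum and the modulus of continuity of the mode on `[0, N)`. If `p ≤ 2m`,
Jensen's inequality gives `𝔼 ∑_n (⟨n⟩^s R_n)^p ≤ C ∑_n (⟨n⟩^s E_n^{1/2})^p`, which is `C` times the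
`p`-th power of the γ-norm (`ae_tsum_chainEnergy_ne_top`). Hence almost surely the weighted modes
are continuous and dominated, locally uniformly in time, by a fixed `ℓ^p` sequence; dominated
convergence yields a continuous path in `ℓ^p`, which is isometric to `FL s p`.

Uniqueness holds mode by mode: Wiener integrals are unique by the isometry, the sum over `k` has a
unique `L²(Ω)` limit, and an element of `FL s p` is determined by its countably many coefficients.
-/

lemma inner_linearCombination (u : ι → H) (x y : ι →₀ ℂ) :
    inner ℂ (Finsupp.linearCombination ℂ u x) (Finsupp.linearCombination ℂ u y)
      = x.sum fun i a => y.sum fun j b => b * (star a * inner ℂ (u i) (u j)) := by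
  simp only [Finsupp.linearCombination_apply, Finsupp.sum, sum_inner]
  simp only [inner_sum, inner_smul_left, inner_smul_right]
  rfl

lemma norm_linearCombination_eq {u : ι → H} {v : ι → H'}
    (h : ∀ i j, inner ℂ (u i) (u j) = inner ℂ (v i) (v j)) (x : ι →₀ ℂ) :
    ‖Finsupp.linearCombination ℂ u x‖ = ‖Finsupp.linearCombination ℂ v x‖ := by
  rw [@norm_eq_sqrt_re_inner ℂ, @norm_eq_sqrt_re_inner ℂ, inner_linearCombination,
    inner_linearCombination]
  simp only [h]

/-- The closure of the relation `∑ c_i u_i ↔ ∑ c_i v_i`. If `u` and `v` have the same Gram matrix,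
this is the graph of an isometry between the closed spans of `u` and `v`. -/
def gramGraph (u : ι → H) (v : ι → H') : Submodule ℂ (H × H') :=
  (LinearMap.range ((Finsupp.linearCombination ℂ u).prod
    (Finsupp.linearCombination ℂ v))).topologicalClosure

variable {u : ι → H} {v : ι → H'}

/-- Closed properties of pairs need only be checked on finite linear combinations; the isometry,
membership and orthogonality statements below all follow this way. -/
lemma gramGraph_induction {p : H × H' → Prop} (hc : IsClosed {z | p z})
    (h : ∀ x, p (Finsupp.linearCombination ℂ u x, Finsupp.linearCombination ℂ v x))
    {z : H × H'} (hz : z ∈ gramGraph u v) : p z := by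
  have h1 : closure (LinearMap.range ((Finsupp.linearCombination ℂ u).prod
      (Finsupp.linearCombination ℂ v)) : Set (H × H')) ⊆ {z | p z} :=
    closure_minimal (by rintro _ ⟨x, rfl⟩; exact h x) hc
  exact h1 hz

lemma mem_gramGraph_of_tendsto {x : ℕ → ι →₀ ℂ} {X : H} {F : H'}
    (hX : Tendsto (fun m => Finsupp.linearCombination ℂ u (x m)) atTop (𝓝 X))
    (hF : Tendsto (fun m => Finsupp.linearCombination ℂ v (x m)) atTop (𝓝 F)) :
    (X, F) ∈ gramGraph u v :=
  mem_closure_of_tendsto (hX.prodMk_nhds hF) (Eventually.of_forall fun m => ⟨x m, rfl⟩)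

lemma norm_eq_of_mem_gramGraph (h : ∀ i j, inner ℂ (u i) (u j) = inner ℂ (v i) (v j))
    {z : H × H'} (hz : z ∈ gramGraph u v) : ‖z.1‖ = ‖z.2‖ :=
  gramGraph_induction (p := fun z => ‖z.1‖ = ‖z.2‖)
    (isClosed_eq (by fun_prop) (by fun_prop)) (norm_linearCombination_eq h) hz

lemma fst_mem_closure_span {z : H × H'} (hz : z ∈ gramGraph u v) :
    z.1 ∈ (Submodule.span ℂ (Set.range u)).topologicalClosure :=
  gramGraph_induction (p := fun z => z.1 ∈ (Submodule.span ℂ (Set.range u)).topologicalClosure)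
    ((Submodule.isClosed_topologicalClosure _).preimage continuous_fst)
    (fun x => Submodule.le_topologicalClosure _ (by
      rw [← Finsupp.range_linearCombination]; exact ⟨x, rfl⟩)) hz

lemma inner_eq_zero_of_mem_gramGraph {u' : ι → H} (h : ∀ i j, inner ℂ (u i) (u' j) = 0)
    {z z' : H × H'} (hz : z ∈ gramGraph u v) (hz' : z' ∈ gramGraph u' v) :
    inner ℂ z.1 z'.1 = 0 := by
  refine gramGraph_induction (p := fun z => inner ℂ z.1 z'.1 = 0)
    (isClosed_eq (by fun_prop) (by fun_prop)) (fun x => ?_) hz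
  refine gramGraph_induction
    (p := fun z' => inner ℂ (Finsupp.linearCombination ℂ u x) z'.1 = 0)
    (isClosed_eq (by fun_prop) (by fun_prop)) (fun y => ?_) hz'
  simp only [Finsupp.linearCombination_apply, Finsupp.sum, sum_inner]
  simp [inner_sum, inner_smul_left, inner_smul_right, h]

/-- Equal Gram matrices carry the Cauchy property from the `v`-combinations to the `u`-combinations.
With `v` the time indicators and `u` a Brownian motion, this is the existence of the Wiener
integral. -/
lemma exists_tendsto_of_gram [CompleteSpace H]
    (h : ∀ i j, inner ℂ (u i) (u j) = inner ℂ (v i) (v j)) {x : ℕ → ι →₀ ℂ} {F : H'}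
    (hF : Tendsto (fun m => Finsupp.linearCombination ℂ v (x m)) atTop (𝓝 F)) :
    ∃ X, Tendsto (fun m => Finsupp.linearCombination ℂ u (x m)) atTop (𝓝 X) := by
  refine cauchySeq_tendsto_of_complete (Metric.cauchySeq_iff.mpr fun ε hε => ?_)
  obtain ⟨N, hN⟩ := Metric.cauchySeq_iff.mp hF.cauchySeq ε hε
  refine ⟨N, fun m hm n hn => ?_⟩
  have := hN m hm n hn
  rwa [dist_eq_norm, ← map_sub, norm_linearCombination_eq h, map_sub, ← dist_eq_norm]

end Gram

/-! ### Brownian motions in `L²` -/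

section Brownian

variable {Ω : Type*} [MeasurableSpace Ω] {P : Measure Ω} {b : ℝ≥0 → Ω → ℂ}

namespace IsComplexBrownian

lemma memLp_re (hb : IsComplexBrownian b P) (t : ℝ≥0) : MemLp (fun ω => (b t ω).re) 2 P := by
  have := ((hb.re.isGaussianProcess.hasGaussianLaw_eval t).memLp_two).const_mul (Real.sqrt 2)⁻¹
  simpa using this

lemma memLp_im (hb : IsComplexBrownian b P) (t : ℝ≥0) : MemLp (fun ω => (b t ω).im) 2 P := by
  have := ((hb.im.isGaussianProcess.hasGaussianLaw_eval t).memLp_two).const_mul (Real.sqrt 2)⁻¹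
  simpa using this

lemma memLp (hb : IsComplexBrownian b P) (t : ℝ≥0) : MemLp (b t) 2 P :=
  memLp_re_im_iff.mp ⟨hb.memLp_re t, hb.memLp_im t⟩

lemma integral_re (hb : IsComplexBrownian b P) (t : ℝ≥0) : ∫ ω, (b t ω).re ∂P = 0 := by
  have := hb.re.integral_eval t
  rw [integral_const_mul] at this
  simpa using this

lemma integral_im (hb : IsComplexBrownian b P) (t : ℝ≥0) : ∫ ω, (b t ω).im ∂P = 0 := by
  have := hb.im.integral_eval t
  rw [integral_const_mul] at this
  simpa using this

lemma integral_re_mul_im (hb : IsComplexBrownian b P) (s t : ℝ≥0) :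
    ∫ ω, (b s ω).re * (b t ω).im ∂P = 0 := by
  have h : IndepFun (fun ω => (b s ω).re) (fun ω => (b t ω).im) P :=
    hb.indep.comp (measurable_pi_apply s) (measurable_pi_apply t)
  rw [h.integral_fun_mul_eq_mul_integral (hb.memLp_re s).1 (hb.memLp_im t).1, hb.integral_re,
    zero_mul]

variable [IsProbabilityMeasure P]

lemma integral_eq_zero (hb : IsComplexBrownian b P) (t : ℝ≥0) : ∫ ω, b t ω ∂P = 0 := by
  rw [← integral_re_add_im ((hb.memLp t).integrable (by norm_num))]
  simp [hb.integral_re, hb.integral_im]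

lemma integral_re_mul_re (hb : IsComplexBrownian b P) (s t : ℝ≥0) :
    ∫ ω, (b s ω).re * (b t ω).re ∂P = (min s t : ℝ≥0) / 2 := by
  have h := hb.re.covariance_fun_eval s t
  rw [covariance_const_mul_left, covariance_const_mul_right,
    covariance_eq_sub (hb.memLp_re s) (hb.memLp_re t), hb.integral_re, zero_mul, sub_zero] at h
  simp only [Pi.mul_apply] at h
  have h2 : Real.sqrt 2 * Real.sqrt 2 = 2 := Real.mul_self_sqrt (by norm_num)
  rw [← mul_assoc, h2] at h
  linarith

lemma integral_im_mul_im (hb : IsComplexBrownian b P) (s t : ℝ≥0) :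
    ∫ ω, (b s ω).im * (b t ω).im ∂P = (min s t : ℝ≥0) / 2 := by
  have h := hb.im.covariance_fun_eval s t
  rw [covariance_const_mul_left, covariance_const_mul_right,
    covariance_eq_sub (hb.memLp_im s) (hb.memLp_im t), hb.integral_im, zero_mul, sub_zero] at h
  simp only [Pi.mul_apply] at h
  have h2 : Real.sqrt 2 * Real.sqrt 2 = 2 := Real.mul_self_sqrt (by norm_num)
  rw [← mul_assoc, h2] at h
  linarith

/-- A complex Brownian motion as a curve in `L²(Ω)`. -/
def toLp (hb : IsComplexBrownian b P) (t : ℝ≥0) : Lp ℂ 2 P := (hb.memLp t).toLp (b t)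

/-- Real and imaginary parts contribute `min s t / 2` each, and the cross terms vanish because the
two parts are independent and centred. -/
lemma inner_toLp (hb : IsComplexBrownian b P) (s t : ℝ≥0) :
    inner ℂ (hb.toLp s) (hb.toLp t) = ((min s t : ℝ≥0) : ℂ) := by
  rw [L2.inner_def]
  have h0 : ∫ ω, inner ℂ ((hb.toLp s : Ω → ℂ) ω) ((hb.toLp t : Ω → ℂ) ω) ∂P
      = ∫ ω, ((((b s ω).re * (b t ω).re + (b s ω).im * (b t ω).im : ℝ) : ℂ)
        + (((b s ω).re * (b t ω).im - (b t ω).re * (b s ω).im : ℝ) : ℂ) * Complex.I) ∂P := by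
    refine integral_congr_ae ?_
    filter_upwards [(hb.memLp s).coeFn_toLp, (hb.memLp t).coeFn_toLp] with ω h1 h2
    rw [toLp, toLp, h1, h2]
    apply Complex.ext <;> simp <;> ring
  have i1 := (hb.memLp_re s).integrable_mul (hb.memLp_re t)
  have i2 := (hb.memLp_im s).integrable_mul (hb.memLp_im t)
  have i3 := (hb.memLp_re s).integrable_mul (hb.memLp_im t)
  have i4 := (hb.memLp_re t).integrable_mul (hb.memLp_im s)
  have e1 : ∫ ω, ((b s ω).re * (b t ω).re + (b s ω).im * (b t ω).im) ∂P = (min s t : ℝ≥0) := by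
    refine (integral_add i1 i2).trans ?_
    simp only [Pi.mul_apply]
    rw [hb.integral_re_mul_re, hb.integral_im_mul_im]; ring
  have e2 : ∫ ω, ((b s ω).re * (b t ω).im - (b t ω).re * (b s ω).im) ∂P = 0 := by
    refine (integral_sub i3 i4).trans ?_
    simp only [Pi.mul_apply]
    rw [hb.integral_re_mul_im, hb.integral_re_mul_im]; ring
  rw [h0, integral_add (i1.add i2).ofReal ((i3.sub i4).ofReal.mul_const _), integral_mul_const,
    integral_complex_ofReal, integral_complex_ofReal, e1, e2]
  simp

end IsComplexBrownian

lemma IsCylindricalWiener.inner_toLp_of_ne [IsProbabilityMeasure P] {β : ℤ → ℝ≥0 → Ω → ℂ}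
    (hβ : IsCylindricalWiener β P) {k l : ℤ} (hkl : k ≠ l) (s t : ℝ≥0) :
    inner ℂ ((hβ.brownian k).toLp s) ((hβ.brownian l).toLp t) = 0 := by
  rw [L2.inner_def]
  have h0 : ∫ ω, inner ℂ (((hβ.brownian k).toLp s : Ω → ℂ) ω) (((hβ.brownian l).toLp t : Ω → ℂ) ω) ∂P
      = ∫ ω, β l t ω * star (β k s ω) ∂P := by
    refine integral_congr_ae ?_
    filter_upwards [((hβ.brownian k).memLp s).coeFn_toLp, ((hβ.brownian l).memLp t).coeFn_toLp]
      with ω h1 h2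
    rw [IsComplexBrownian.toLp, IsComplexBrownian.toLp, h1, h2]
    rfl
  have h : IndepFun (fun ω => β l t ω) (fun ω => star (β k s ω)) P :=
    (hβ.indep.indepFun hkl.symm).comp (φ := fun x : ℝ≥0 → ℂ => x t)
      (ψ := fun x : ℝ≥0 → ℂ => star (x s)) (measurable_pi_apply t)
      (by fun_prop)
  rw [h0, h.integral_fun_mul_eq_mul_integral ((hβ.brownian l).memLp t).1
    ((hβ.brownian k).memLp s).1.star, (hβ.brownian l).integral_eq_zero, zero_mul]

/-! ### Step functions -/

/-- The indicator of `(0, t]` as an element of `L²(ℝ)`. -/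
def timeIndicator (t : ℝ≥0) : Lp ℂ 2 (volume : Measure ℝ) :=
  indicatorConstLp 2 (measurableSet_Ioc (a := (0 : ℝ)) (b := t)) (by simp) 1

/-- The same Gram matrix as a complex Brownian motion: this coincidence is the Itô isometry. -/
lemma inner_timeIndicator (s t : ℝ≥0) :
    inner ℂ (timeIndicator s) (timeIndicator t) = ((min s t : ℝ≥0) : ℂ) := by
  rw [timeIndicator, timeIndicator, L2.inner_indicatorConstLp_one_indicatorConstLp_one (hμs := by simp) (hμt := by simp),
    Set.Ioc_inter_Ioc]
  simp

lemma IsComplexBrownian.inner_toLp_eq [IsProbabilityMeasure P] (hb : IsComplexBrownian b P)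
    (s t : ℝ≥0) :
    inner ℂ (hb.toLp s) (hb.toLp t) = inner ℂ (timeIndicator s) (timeIndicator t) := by
  rw [hb.inner_toLp, inner_timeIndicator]

namespace StepFunction

variable {t : ℝ≥0}

/-- The coefficients of a step function with respect to the indicators of the intervals `(0, r]`. -/
def toFinsupp (h : StepFunction t) : ℝ≥0 →₀ ℂ :=
  ∑ j ∈ Finset.range h.size, (Finsupp.single (h.pt (j + 1)) (h.val j) -
    Finsupp.single (h.pt j) (h.val j))

lemma linearCombination_toFinsupp {H : Type*} [AddCommGroup H] [Module ℂ H] (u : ℝ≥0 → H)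
    (h : StepFunction t) : Finsupp.linearCombination ℂ u h.toFinsupp
      = ∑ j ∈ Finset.range h.size, h.val j • (u (h.pt (j + 1)) - u (h.pt j)) := by
  simp [toFinsupp, map_sum, Finsupp.linearCombination_single, smul_sub]

lemma coeFn_linearCombination_brownian (h : StepFunction t) [IsProbabilityMeasure P]
    (hb : IsComplexBrownian b P) :
    (Finsupp.linearCombination ℂ hb.toLp h.toFinsupp : Ω → ℂ) =ᵐ[P] h.integral b := by
  rw [linearCombination_toFinsupp]
  refine (Lp.coeFn_finsetSum _ _).trans ?_
  have h1 : ∀ r, (hb.toLp r : Ω → ℂ) =ᵐ[P] b r := fun r => (hb.memLp r).coeFn_toLp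
  have h2 : ∀ᵐ ω ∂P, ∀ j : ℕ, ((h.val j • (hb.toLp (h.pt (j + 1)) - hb.toLp (h.pt j)) : Lp ℂ 2 P) :
      Ω → ℂ) ω = h.val j * (b (h.pt (j + 1)) ω - b (h.pt j) ω) := by
    refine ae_all_iff.mpr fun j => ?_
    filter_upwards [Lp.coeFn_smul (h.val j) (hb.toLp (h.pt (j + 1)) - hb.toLp (h.pt j)),
      Lp.coeFn_sub (hb.toLp (h.pt (j + 1))) (hb.toLp (h.pt j)), h1 (h.pt (j + 1)),
      h1 (h.pt j)] with ω e1 e2 e3 e4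
    rw [e1, Pi.smul_apply, e2, Pi.sub_apply, e3, e4, smul_eq_mul]
  filter_upwards [h2] with ω hω
  simp [integral, hω]

lemma coeFn_linearCombination_timeIndicator (h : StepFunction t) :
    (Finsupp.linearCombination ℂ timeIndicator h.toFinsupp : ℝ → ℂ) =ᵐ[volume] h.toFun := by
  rw [linearCombination_toFinsupp]
  refine (Lp.coeFn_finsetSum _ _).trans ?_
  have h1 : ∀ r : ℝ≥0, (timeIndicator r : ℝ → ℂ) =ᵐ[volume]
      (Set.Ioc (0 : ℝ) r).indicator fun _ => (1 : ℂ) := fun r => indicatorConstLp_coeFn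
  have h2 : ∀ᵐ x : ℝ, ∀ j : ℕ, ((h.val j • (timeIndicator (h.pt (j + 1)) - timeIndicator (h.pt j)) :
      Lp ℂ 2 (volume : Measure ℝ)) : ℝ → ℂ) x
      = (Set.Ioc (h.pt j : ℝ) (h.pt (j + 1) : ℝ)).indicator (fun _ => h.val j) x := by
    refine ae_all_iff.mpr fun j => ?_
    filter_upwards [Lp.coeFn_smul (h.val j) (timeIndicator (h.pt (j + 1)) - timeIndicator (h.pt j)),
      Lp.coeFn_sub (timeIndicator (h.pt (j + 1))) (timeIndicator (h.pt j)), h1 (h.pt (j + 1)),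
      h1 (h.pt j)] with x e1 e2 e3 e4
    rw [e1, Pi.smul_apply, e2, Pi.sub_apply, e3, e4, smul_eq_mul]
    have hm : (h.pt j : ℝ) ≤ h.pt (j + 1) := h.mono (Nat.le_succ j)
    have h0 : (0 : ℝ) ≤ h.pt j := NNReal.coe_nonneg _
    by_cases hx1 : 0 < x <;> by_cases hx2 : x ≤ h.pt j <;> by_cases hx3 : x ≤ h.pt (j + 1) <;>
      simp [Set.indicator, hx1, hx2, hx3] <;> grind
  filter_upwards [h2] with x hx
  simp [toFun, hx]

lemma toFun_eq_indicator (h : StepFunction t) :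
    h.toFun = (Set.Ioc (0 : ℝ) t).indicator h.toFun := by
  funext x
  by_cases hx : x ∈ Set.Ioc (0 : ℝ) t
  · rw [Set.indicator_of_mem hx]
  · rw [Set.indicator_of_notMem hx]
    refine Finset.sum_eq_zero fun j _ => Set.indicator_of_notMem (fun hj => hx ⟨?_, ?_⟩) _
    · exact (NNReal.coe_nonneg _).trans_lt hj.1
    · exact hj.2.trans (by exact_mod_cast h.le (j + 1))

end StepFunction

end Brownian

/-! ### Moments of Gaussian variables -/

section GaussianMoments

lemma eLpNorm_id_gaussianReal_two_ne_zero : eLpNorm id 2 (gaussianReal 0 1) ≠ 0 := by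
  intro h
  rw [eLpNorm_eq_zero_iff measurable_id.aestronglyMeasurable (by norm_num)] at h
  have h1 := variance_congr h
  rw [variance_id_gaussianReal] at h1
  simp at h1

/-- The ratio of the `L^q` norm and the `L²` norm of a centred Gaussian variable. -/
def gaussianRatio (q : ℝ≥0∞) : ℝ≥0∞ :=
  eLpNorm id q (gaussianReal 0 1) / eLpNorm id 2 (gaussianReal 0 1)

lemma gaussianRatio_ne_top {q : ℝ≥0∞} (hq : q ≠ ∞) : gaussianRatio q ≠ ∞ :=
  ENNReal.div_ne_top (memLp_id_gaussianReal' q hq).eLpNorm_ne_top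
    eLpNorm_id_gaussianReal_two_ne_zero

variable {Ω : Type*} [MeasurableSpace Ω] {P : Measure Ω}

/-- A centred Gaussian variable has the law of its standard deviation times a standard one, so all
its `L^q` norms scale alike. -/
lemma eLpNorm_of_hasGaussianLaw {Z : Ω → ℝ} (hZ : HasGaussianLaw Z P) (h0 : ∫ ω, Z ω ∂P = 0)
    (q : ℝ≥0∞) :
    eLpNorm Z q P = ‖Real.sqrt (variance Z P)‖ₑ * eLpNorm id q (gaussianReal 0 1) := by
  have h1 : P.map Z = (gaussianReal 0 1).map (fun x => Real.sqrt (variance Z P) * x) := by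
    rw [hZ.map_eq_gaussianReal, h0, gaussianReal_map_const_mul]
    congr 1
    · simp
    · ext
      simp [Real.sq_sqrt (variance_nonneg Z P), Real.coe_toNNReal _ (variance_nonneg Z P)]
  calc eLpNorm Z q P = eLpNorm id q (P.map Z) := by
        rw [eLpNorm_map_measure measurable_id.aestronglyMeasurable hZ.aemeasurable]; rfl
    _ = eLpNorm (Real.sqrt (variance Z P) • (id : ℝ → ℝ)) q (gaussianReal 0 1) := by
        rw [h1, eLpNorm_map_measure measurable_id.aestronglyMeasurable (by fun_prop)]; rfl
    _ = _ := eLpNorm_const_smul _ _ _ _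

lemma eLpNorm_le_of_hasGaussianLaw {Z : Ω → ℝ} (hZ : HasGaussianLaw Z P)
    (h0 : ∫ ω, Z ω ∂P = 0) (q : ℝ≥0∞) :
    eLpNorm Z q P ≤ gaussianRatio q * eLpNorm Z 2 P := by
  rw [eLpNorm_of_hasGaussianLaw hZ h0, eLpNorm_of_hasGaussianLaw hZ h0, gaussianRatio,
    mul_left_comm, ENNReal.div_mul_cancel eLpNorm_id_gaussianReal_two_ne_zero
      (memLp_id_gaussianReal' 2 (by norm_num)).eLpNorm_ne_top]

variable {b : ℝ≥0 → Ω → ℂ}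

/-- Since `Re (c b) = Re c Re b - Im c Im b`, the sum splits into two independent Gaussian
variables. -/
lemma IsComplexBrownian.hasGaussianLaw_re_sum (hb : IsComplexBrownian b P) (G : Finset ℝ≥0)
    (c : ℝ≥0 → ℂ) : HasGaussianLaw (fun ω => (∑ t ∈ G, c t * b t ω).re) P := by
  have hs : Real.sqrt 2 ≠ 0 := by positivity
  have h1 : HasGaussianLaw (fun ω => ∑ t ∈ G, (c t).re * (b t ω).re) P := by
    have := (hb.re.isGaussianProcess.smul fun t => (c t).re * (Real.sqrt 2)⁻¹).hasGaussianLaw_fun_sum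
      (I := G)
    refine this.congr (ae_of_all _ fun ω => Finset.sum_congr rfl fun t _ => ?_)
    simp only [smul_eq_mul]
    field_simp
  have h2 : HasGaussianLaw (fun ω => ∑ t ∈ G, (-(c t).im) * (b t ω).im) P := by
    have := (hb.im.isGaussianProcess.smul
      fun t => -(c t).im * (Real.sqrt 2)⁻¹).hasGaussianLaw_fun_sum (I := G)
    refine this.congr (ae_of_all _ fun ω => Finset.sum_congr rfl fun t _ => ?_)
    simp only [smul_eq_mul]
    field_simp
  have h3 : IndepFun (fun ω => ∑ t ∈ G, (c t).re * (b t ω).re)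
      (fun ω => ∑ t ∈ G, (-(c t).im) * (b t ω).im) P :=
    hb.indep.comp (φ := fun x : ℝ≥0 → ℝ => ∑ t ∈ G, (c t).re * x t)
      (ψ := fun x : ℝ≥0 → ℝ => ∑ t ∈ G, (-(c t).im) * x t) (by fun_prop) (by fun_prop)
  convert! iIndepFun.hasGaussianLaw_fun_add h1 h2 h3 using 2 with ω
  rw [Complex.re_sum, ← Finset.sum_add_distrib]
  refine Finset.sum_congr rfl fun t _ => ?_
  rw [Complex.mul_re]
  ring

variable {β : ℤ → ℝ≥0 → Ω → ℂ}

/-- The first chaos of the cylindrical Wiener process, before taking the closure. -/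
def chaosSpan (hβ : IsCylindricalWiener β P) : Submodule ℂ (Lp ℂ 2 P) :=
  Submodule.span ℂ (Set.range fun i : ℤ × ℝ≥0 => (hβ.brownian i.1).toLp i.2)

/-- Grouping the terms by the index of the Brownian motion gives a finite sum of independent
Gaussian variables. -/
lemma hasGaussianLaw_re_of_mem_chaosSpan (hβ : IsCylindricalWiener β P) {X : Lp ℂ 2 P}
    (hX : X ∈ chaosSpan hβ) : HasGaussianLaw (fun ω => (X ω).re) P := by
  obtain ⟨c, rfl⟩ := Finsupp.mem_span_range_iff_exists_finsupp.mp hX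
  classical
  set F := c.support.image Prod.fst
  set G := c.support.image Prod.snd
  have hmeas : ∀ k : F, HasGaussianLaw (fun ω => (∑ t ∈ G, c (k, t) * β k t ω).re) P :=
    fun k => (hβ.brownian k).hasGaussianLaw_re_sum G fun t => c (k, t)
  have hind : iIndepFun (fun (k : F) ω => (∑ t ∈ G, c (k, t) * β k t ω).re) P :=
    (hβ.indep.precomp (g := fun k : F => (k : ℤ)) Subtype.val_injective).comp
      (fun k (x : ℝ≥0 → ℂ) => (∑ t ∈ G, c (k, t) * x t).re) (fun k => by
        refine Complex.measurable_re.comp ?_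
        fun_prop)
  refine (iIndepFun.hasGaussianLaw_fun_sum hmeas hind).congr ?_
  have h1 : ∀ᵐ ω ∂P, ∀ i ∈ c.support, ((c i • (hβ.brownian i.1).toLp i.2 : Lp ℂ 2 P) : Ω → ℂ) ω
      = c i * β i.1 i.2 ω := by
    refine (Finset.eventually_all _).mpr fun i _ => ?_
    filter_upwards [Lp.coeFn_smul (c i) ((hβ.brownian i.1).toLp i.2),
      ((hβ.brownian i.1).memLp i.2).coeFn_toLp] with ω e1 e2
    rw [e1, Pi.smul_apply, smul_eq_mul, IsComplexBrownian.toLp, e2]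
  filter_upwards [h1, Lp.coeFn_finsetSum c.support
    (fun i => c i • (hβ.brownian i.1).toLp i.2)] with ω e1 e2
  rw [Finsupp.sum, e2, Finset.sum_apply, Finset.sum_congr rfl e1,
    Finset.sum_coe_sort F (fun k => (∑ t ∈ G, c (k, t) * β k t ω).re), ← Complex.re_sum,
    ← Finset.sum_product' F G (fun k t => c (k, t) * β k t ω)]
  congr 1
  symm
  -- The support is enlarged to the product of its projections; the added coefficients are zero.
  refine Finset.sum_subset (fun i hi => Finset.mem_product.mpr
    ⟨Finset.mem_image_of_mem _ hi, Finset.mem_image_of_mem _ hi⟩) fun i _ hi => ?_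
  rw [Finsupp.notMem_support_iff.mp hi, zero_mul]

variable [IsProbabilityMeasure P]

lemma integral_eq_zero_of_mem_chaosSpan (hβ : IsCylindricalWiener β P) {X : Lp ℂ 2 P}
    (hX : X ∈ chaosSpan hβ) : ∫ ω, X ω ∂P = 0 := by
  have hi : ∀ Y : Lp ℂ 2 P, Integrable Y P := fun Y => (Lp.memLp Y).integrable (by norm_num)
  induction hX using Submodule.span_induction with
  | mem Y h =>
    obtain ⟨i, rfl⟩ := h
    rw [← (hβ.brownian i.1).integral_eq_zero i.2]
    exact integral_congr_ae ((hβ.brownian i.1).memLp i.2).coeFn_toLp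
  | zero => exact (integral_congr_ae (Lp.coeFn_zero ℂ 2 P)).trans (by simp)
  | add Y Z _ _ h1 h2 =>
    rw [integral_congr_ae (Lp.coeFn_add Y Z)]
    exact (integral_add (hi Y) (hi Z)).trans (by rw [h1, h2, add_zero])
  | smul a Y _ h =>
    rw [integral_congr_ae (Lp.coeFn_smul a Y)]
    exact (integral_const_mul a _).trans (by rw [h, mul_zero])

lemma eLpNorm_re_le_of_mem_chaosSpan (hβ : IsCylindricalWiener β P) {X : Lp ℂ 2 P}
    (hX : X ∈ chaosSpan hβ) (q : ℝ≥0∞) :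
    eLpNorm (fun ω => (X ω).re) q P ≤ gaussianRatio q * eLpNorm X 2 P := by
  have h0 : ∫ ω, (X ω).re ∂P = 0 := by
    have := integral_re ((Lp.memLp X).integrable (by norm_num))
    rw [integral_eq_zero_of_mem_chaosSpan hβ hX] at this
    simpa using this
  refine (eLpNorm_le_of_hasGaussianLaw (hasGaussianLaw_re_of_mem_chaosSpan hβ hX) h0 q).trans ?_
  gcongr
  exact eLpNorm_mono fun ω => Complex.abs_re_le_norm _

lemma eLpNorm_le_of_mem_chaosSpan (hβ : IsCylindricalWiener β P) {X : Lp ℂ 2 P}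
    (hX : X ∈ chaosSpan hβ) {q : ℝ≥0∞} (hq : 1 ≤ q) :
    eLpNorm X q P ≤ 2 * gaussianRatio q * eLpNorm X 2 P := by
  have h1 := eLpNorm_re_le_of_mem_chaosSpan hβ hX q
  have h2 : eLpNorm (fun ω => (X ω).im) q P ≤ gaussianRatio q * eLpNorm X 2 P := by
    -- The span is complex, so `Im X = Re (-iX)` reduces the imaginary part to the real one.
    have h3 := eLpNorm_re_le_of_mem_chaosSpan hβ
      ((chaosSpan hβ).smul_mem (-Complex.I) hX) q
    have h4 := Lp.coeFn_smul (-Complex.I) X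
    rw [eLpNorm_congr_ae h4, eLpNorm_const_smul] at h3
    have h5 : (fun ω => ((-Complex.I • X : Lp ℂ 2 P) ω).re) =ᵐ[P] fun ω => (X ω).im := by
      filter_upwards [h4] with ω e
      rw [e]; simp
    rw [eLpNorm_congr_ae h5] at h3
    simpa [enorm_eq_nnnorm] using h3
  have m1 : AEStronglyMeasurable (fun ω => (X ω).re) P :=
    Complex.continuous_re.comp_aestronglyMeasurable (Lp.aestronglyMeasurable X)
  have m2 : AEStronglyMeasurable (fun ω => (X ω).im) P :=
    Complex.continuous_im.comp_aestronglyMeasurable (Lp.aestronglyMeasurable X)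
  calc eLpNorm X q P ≤ eLpNorm (fun ω => ‖(X ω).re‖ + ‖(X ω).im‖) q P :=
        eLpNorm_mono_real fun ω => Complex.norm_le_abs_re_add_abs_im _
    _ ≤ eLpNorm (fun ω => ‖(X ω).re‖) q P + eLpNorm (fun ω => ‖(X ω).im‖) q P :=
        eLpNorm_add_le m1.norm m2.norm hq
    _ ≤ gaussianRatio q * eLpNorm X 2 P + gaussianRatio q * eLpNorm X 2 P := by
        rw [eLpNorm_norm, eLpNorm_norm]
        exact add_le_add h1 h2
    _ = _ := by ring

/-- In the first chaos all the `L^q` norms are controlled by the `L²` norm. -/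
lemma eLpNorm_le_of_mem_closure_chaosSpan (hβ : IsCylindricalWiener β P) {X : Lp ℂ 2 P}
    (hX : X ∈ (chaosSpan hβ).topologicalClosure) {q : ℝ≥0∞} (hq : 1 ≤ q) (hq' : q ≠ ∞) :
    eLpNorm X q P ≤ 2 * gaussianRatio q * eLpNorm X 2 P := by
  obtain ⟨Y, hY, hYX⟩ := mem_closure_iff_seq_limit.mp hX
  -- Fatou's lemma along an almost surely convergent subsequence passes the bound to the limit, so
  -- the limit itself need not be shown Gaussian.
  obtain ⟨ns, hns, hae⟩ := (tendstoInMeasure_of_tendsto_Lp hYX).exists_seq_tendsto_ae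
  have hlim : Tendsto (fun n => 2 * gaussianRatio q * eLpNorm (Y (ns n)) 2 P) atTop
      (𝓝 (2 * gaussianRatio q * eLpNorm X 2 P)) := by
    refine ENNReal.Tendsto.const_mul ?_ (Or.inr
      (ENNReal.mul_ne_top (by norm_num) (gaussianRatio_ne_top hq')))
    have h1 : ∀ Z : Lp ℂ 2 P, eLpNorm Z 2 P = ENNReal.ofReal ‖Z‖ := fun Z => by
      rw [Lp.norm_def, ENNReal.ofReal_toReal (Lp.eLpNorm_ne_top Z)]
    simp only [h1]
    exact ENNReal.tendsto_ofReal ((hYX.comp hns.tendsto_atTop).norm)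
  calc eLpNorm X q P ≤ liminf (fun n => eLpNorm (Y (ns n)) q P) atTop :=
        Lp.eLpNorm_lim_le_liminf_eLpNorm (fun n => Lp.aestronglyMeasurable _) _ hae
    _ ≤ liminf (fun n => 2 * gaussianRatio q * eLpNorm (Y (ns n)) 2 P) atTop :=
        liminf_le_liminf (Eventually.of_forall fun n => eLpNorm_le_of_mem_chaosSpan hβ (hY _) hq)
    _ = _ := hlim.liminf_eq

end GaussianMoments

/-! ### Wiener integrals -/

section WienerIntegral

/-- The step function on `[0, t]` that interpolates `f` at the left end points of `m + 1` intervals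
of equal length. -/
def riemannStep (f : ℝ → ℂ) (t : ℝ≥0) (m : ℕ) : StepFunction t where
  -- Using `m + 1` intervals avoids division by zero; the minimum with `t` keeps the points of every
  -- index, also beyond `size`, inside `[0, t]`.
  size := m + 1
  pt j := min (j * (t / (m + 1))) t
  val j := f (min (j * (t / (m + 1))) t : ℝ≥0)
  mono := fun i j hij => by
    have : (i : ℝ≥0) ≤ j := by exact_mod_cast hij
    dsimp only
    gcongr
  le j := min_le_right _ _

/-- The intervals partition `(pt 0, pt size]`, so at `x` the step function is an average with 0-1
weights of total mass one, obtained by telescoping `g`. -/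
lemma StepFunction.norm_toFun_sub_le {t : ℝ≥0} (h : StepFunction t) {z : ℂ} {x ε : ℝ}
    (h0 : (h.pt 0 : ℝ) < x) (h1 : x ≤ h.pt h.size)
    (hε : ∀ j < h.size, (h.pt j : ℝ) < x → x ≤ h.pt (j + 1) → ‖h.val j - z‖ ≤ ε) :
    ‖h.toFun x - z‖ ≤ ε := by
  let g : ℕ → ℝ := fun j => if x ≤ h.pt j then 1 else 0
  have hg : ∀ j, g (j + 1) - g j
      = (Set.Ioc (h.pt j : ℝ) (h.pt (j + 1) : ℝ)).indicator (fun _ => (1 : ℝ)) x := fun j => by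
    have hm : (h.pt j : ℝ) ≤ h.pt (j + 1) := h.mono (Nat.le_succ j)
    simp only [g, Set.indicator, Set.mem_Ioc]
    grind
  have hsum : ∑ j ∈ Finset.range h.size,
      (Set.Ioc (h.pt j : ℝ) (h.pt (j + 1) : ℝ)).indicator (fun _ => (1 : ℝ)) x = 1 := by
    simp only [← hg]
    rw [Finset.sum_range_sub]
    simp [g, h1, not_le.mpr h0]
  have hz : h.toFun x - z = ∑ j ∈ Finset.range h.size,
      (Set.Ioc (h.pt j : ℝ) (h.pt (j + 1) : ℝ)).indicator (fun _ => h.val j - z) x := by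
    have hz1 : z = ∑ j ∈ Finset.range h.size,
        (((Set.Ioc (h.pt j : ℝ) (h.pt (j + 1) : ℝ)).indicator (fun _ => (1 : ℝ)) x : ℝ) : ℂ) * z := by
      rw [← Finset.sum_mul, ← Complex.ofReal_sum, hsum]; simp
    nth_rewrite 1 [hz1]
    rw [StepFunction.toFun, ← Finset.sum_sub_distrib]
    refine Finset.sum_congr rfl fun j _ => ?_
    by_cases hx : x ∈ Set.Ioc (h.pt j : ℝ) (h.pt (j + 1) : ℝ) <;> simp [hx]
  rw [hz]
  calc _ ≤ ∑ j ∈ Finset.range h.size,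
        (Set.Ioc (h.pt j : ℝ) (h.pt (j + 1) : ℝ)).indicator (fun _ => (1 : ℝ)) x * ε := by
        refine norm_sum_le_of_le _ fun j hj => ?_
        by_cases hx : x ∈ Set.Ioc (h.pt j : ℝ) (h.pt (j + 1) : ℝ)
        · simpa [hx] using hε j (Finset.mem_range.mp hj) hx.1 hx.2
        · simp [hx]
    _ = ε := by rw [← Finset.sum_mul, hsum, one_mul]

lemma tendsto_riemannStep {f : ℝ → ℂ} (hf : Continuous f) (t : ℝ≥0) :
    Tendsto (fun m => eLpNorm (fun r => (riemannStep f t m).toFun r - f r) 2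
      (volume.restrict (Set.Ioc (0 : ℝ) t))) atTop (𝓝 0) := by
  have huc : UniformContinuousOn f (Set.Icc 0 t) :=
    isCompact_Icc.uniformContinuousOn_of_continuous hf.continuousOn
  have hunif : ∀ δ > 0, ∀ᶠ m : ℕ in atTop, ∀ x ∈ Set.Ioc (0 : ℝ) t,
      ‖(riemannStep f t m).toFun x - f x‖ ≤ δ := by
    intro δ hδ
    obtain ⟨η, hη, H⟩ := Metric.uniformContinuousOn_iff.mp huc δ hδ
    have h1 : Tendsto (fun m : ℕ => (t : ℝ) * (1 / ((m : ℝ) + 1))) atTop (𝓝 0) := by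
      simpa using tendsto_one_div_add_atTop_nhds_zero_nat.const_mul (t : ℝ)
    filter_upwards [h1.eventually (gt_mem_nhds hη)] with m hm x hx
    refine (riemannStep f t m).norm_toFun_sub_le ?_ ?_ fun j _ h2 h3 => ?_
    · simpa [riemannStep] using hx.1
    · have : ((m + 1 : ℕ) : ℝ≥0) * (t / (m + 1)) = t := by
        push_cast; field_simp
      simp only [riemannStep, this, min_self]
      exact hx.2
    · simp only [riemannStep] at h2 h3 ⊢
      rw [← dist_eq_norm]
      refine (H _ ⟨NNReal.coe_nonneg _, by exact_mod_cast min_le_right _ _⟩ x ⟨hx.1.le, hx.2⟩ ?_).le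
      rw [Real.dist_eq, abs_sub_comm, abs_of_pos (sub_pos.mpr h2)]
      have h4 : x ≤ ((j : ℝ) + 1) * (t / (m + 1)) := by
        have := h3.trans (NNReal.coe_le_coe.mpr (min_le_left _ _))
        push_cast at this
        exact this
      push_cast at h2 ⊢
      rcases min_choice ((j : ℝ) * (t / (m + 1))) t with h5 | h5
      · rw [h5]
        have : (t : ℝ) * (1 / (m + 1)) = t / (m + 1) := by ring
        linarith
      · rw [h5] at h2
        exact absurd hx.2 (not_le.mpr h2)
  set c : ℝ≥0∞ := (volume.restrict (Set.Ioc (0 : ℝ) t)) Set.univ ^ (2 : ℝ≥0∞).toReal⁻¹ with hc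
  have hct : c ≠ ∞ := by
    rw [hc]
    exact ENNReal.rpow_ne_top_of_nonneg (by positivity) (by simp)
  rw [ENNReal.tendsto_nhds_zero]
  intro ε hε
  rcases eq_or_ne ε ∞ with rfl | hεt
  · exact Eventually.of_forall fun _ => le_top
  have hε' : 0 < ε.toReal := ENNReal.toReal_pos hε.ne' hεt
  -- Here `c` is the square root of the length of the interval; the `+ 1` covers `t = 0`, where `c`
  -- vanishes.
  filter_upwards [hunif (ε.toReal / (c.toReal + 1)) (by positivity)] with m hm
  calc _ ≤ c * ENNReal.ofReal (ε.toReal / (c.toReal + 1)) :=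
        eLpNorm_le_of_ae_bound ((ae_restrict_iff' measurableSet_Ioc).mpr (ae_of_all _ hm))
    _ = ENNReal.ofReal (c.toReal * (ε.toReal / (c.toReal + 1))) := by
        rw [ENNReal.ofReal_mul ENNReal.toReal_nonneg, ENNReal.ofReal_toReal hct]
    _ ≤ ENNReal.ofReal ε.toReal := by
        refine ENNReal.ofReal_le_ofReal ?_
        rw [mul_div_assoc', div_le_iff₀ (by positivity)]
        nlinarith
    _ = ε := ENNReal.ofReal_toReal hεt

variable {Ω : Type*} [MeasurableSpace Ω] {P : Measure Ω} [IsProbabilityMeasure P]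
  {b : ℝ≥0 → Ω → ℂ}

lemma memLp_indicator_of_continuous {f : ℝ → ℂ} (hf : Continuous f) (t : ℝ≥0) :
    MemLp ((Set.Ioc (0 : ℝ) t).indicator f) 2 volume := by
  rw [memLp_indicator_iff_restrict measurableSet_Ioc]
  obtain ⟨C, hC⟩ := (isCompact_Icc (a := (0 : ℝ)) (b := t)).exists_bound_of_continuousOn
    hf.continuousOn
  exact MemLp.of_bound hf.aestronglyMeasurable C ((ae_restrict_iff' measurableSet_Ioc).mpr
    (ae_of_all _ fun x hx => hC x (Set.Ioc_subset_Icc_self hx)))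

/-- The restriction of a continuous function to `(0, t]` as an element of `L²(ℝ)`. -/
def restrictLp {f : ℝ → ℂ} (hf : Continuous f) (t : ℝ≥0) : Lp ℂ 2 (volume : Measure ℝ) :=
  (memLp_indicator_of_continuous hf t).toLp _

lemma restrictLp_eq_smul {f g : ℝ → ℂ} (hf : Continuous f) (hg : Continuous g) {c : ℂ}
    (h : ∀ r, f r = c * g r) (t : ℝ≥0) : restrictLp hf t = c • restrictLp hg t := by
  have hm := (memLp_indicator_of_continuous hg t).const_smul c
  have h1 : restrictLp hf t = hm.toLp _ := by
    refine MemLp.toLp_congr _ _ (ae_of_all _ fun x => ?_)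
    by_cases hx : x ∈ Set.Ioc (0 : ℝ) t
    · simp only [Pi.smul_apply, Set.indicator_of_mem hx, smul_eq_mul, h]
    · simp [Set.indicator_of_notMem hx]
  exact h1.trans (MemLp.toLp_const_smul _ _)

lemma restrictLp_zero {f : ℝ → ℂ} (hf : Continuous f) : restrictLp hf 0 = 0 := by
  rw [← norm_eq_zero, restrictLp, Lp.norm_toLp]
  simp

lemma tendsto_timeIndicator_iff {f : ℝ → ℂ} (hf : Continuous f) {t : ℝ≥0}
    (h : ℕ → StepFunction t) :
    Tendsto (fun m => Finsupp.linearCombination ℂ timeIndicator (h m).toFinsupp) atTop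
      (𝓝 (restrictLp hf t)) ↔
    Tendsto (fun m => eLpNorm (fun r => (h m).toFun r - f r) 2
      (volume.restrict (Set.Ioc (0 : ℝ) t))) atTop (𝓝 0) := by
  rw [Lp.tendsto_Lp_iff_tendsto_eLpNorm']
  refine tendsto_congr fun m => ?_
  rw [← eLpNorm_indicator_eq_eLpNorm_restrict measurableSet_Ioc]
  refine eLpNorm_congr_ae ?_
  filter_upwards [(h m).coeFn_linearCombination_timeIndicator,
    (memLp_indicator_of_continuous hf t).coeFn_toLp] with x e1 e2
  rw [Pi.sub_apply, e1, restrictLp, e2, (h m).toFun_eq_indicator]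
  by_cases hx : x ∈ Set.Ioc (0 : ℝ) t <;> simp [hx]

lemma tendsto_brownian_iff (hb : IsComplexBrownian b P) {t : ℝ≥0} (h : ℕ → StepFunction t)
    {X : Lp ℂ 2 P} {X' : Ω → ℂ} (hX : X =ᵐ[P] X') :
    Tendsto (fun m => Finsupp.linearCombination ℂ hb.toLp (h m).toFinsupp) atTop (𝓝 X) ↔
    Tendsto (fun m => eLpNorm (fun ω => (h m).integral b ω - X' ω) 2 P) atTop (𝓝 0) := by
  rw [Lp.tendsto_Lp_iff_tendsto_eLpNorm']
  refine tendsto_congr fun m => eLpNorm_congr_ae ?_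
  filter_upwards [(h m).coeFn_linearCombination_brownian hb, hX] with ω e1 e2
  rw [Pi.sub_apply, e1, e2]

lemma IsWienerIntegral.mem_gramGraph (hb : IsComplexBrownian b P) {f : ℝ → ℂ} (hf : Continuous f)
    {t : ℝ≥0} {X : Ω → ℂ} (h : IsWienerIntegral b P t f X) :
    (h.1.toLp X, restrictLp hf t) ∈ gramGraph hb.toLp timeIndicator := by
  obtain ⟨hX, h, h1, h2⟩ := h
  exact mem_gramGraph_of_tendsto ((tendsto_brownian_iff hb h hX.coeFn_toLp).mpr h2)
    ((tendsto_timeIndicator_iff hf h).mpr h1)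

/-- Two versions of a Wiener integral agree almost surely. -/
lemma IsWienerIntegral.ae_eq (hb : IsComplexBrownian b P) {f : ℝ → ℂ} (hf : Continuous f)
    {t : ℝ≥0} {X X' : Ω → ℂ} (h : IsWienerIntegral b P t f X)
    (h' : IsWienerIntegral b P t f X') : X =ᵐ[P] X' := by
  -- The graph is a subspace: the difference of the two integrals is paired with `0`, hence has norm
  -- zero.
  have h1 := norm_eq_of_mem_gramGraph hb.inner_toLp_eq
    (Submodule.sub_mem _ (h.mem_gramGraph hb hf) (h'.mem_gramGraph hb hf))
  simp only [Prod.fst_sub, Prod.snd_sub, sub_self, norm_zero, norm_eq_zero, sub_eq_zero] at h1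
  exact (MemLp.toLp_eq_toLp_iff h.1 h'.1).mp h1

lemma exists_isWienerIntegral (hb : IsComplexBrownian b P) {f : ℝ → ℂ} (hf : Continuous f)
    (t : ℝ≥0) : ∃ X : Lp ℂ 2 P, IsWienerIntegral b P t f X ∧
      (X, restrictLp hf t) ∈ gramGraph hb.toLp timeIndicator := by
  have h1 := (tendsto_timeIndicator_iff hf (riemannStep f t)).mpr (tendsto_riemannStep hf t)
  obtain ⟨X, hX⟩ := exists_tendsto_of_gram hb.inner_toLp_eq h1
  exact ⟨X, ⟨Lp.memLp X, riemannStep f t, tendsto_riemannStep hf t,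
    (tendsto_brownian_iff hb _ (ae_eq_refl _)).mp hX⟩, mem_gramGraph_of_tendsto hX h1⟩

/-- The difference lives on `(s, t]` and has constant modulus there, as do the integrands `σ(-r)
a_k`. -/
lemma norm_restrictLp_sub {f : ℝ → ℂ} (hf : Continuous f) {c : ℝ} (hc : ∀ r, ‖f r‖ = c)
    {s t : ℝ≥0} (hst : s ≤ t) :
    ‖restrictLp hf t - restrictLp hf s‖ ^ 2 = (t - s) * c ^ 2 := by
  have hst' : (s : ℝ) ≤ t := hst
  have hc0 : 0 ≤ c := (hc 0) ▸ norm_nonneg _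
  have h1 : eLpNorm (restrictLp hf t - restrictLp hf s : Lp ℂ 2 (volume : Measure ℝ)) 2 volume
      = eLpNorm ((Set.Ioc (s : ℝ) t).indicator fun _ => c) 2 volume := by
    refine eLpNorm_congr_norm_ae ?_
    filter_upwards [Lp.coeFn_sub (restrictLp hf t) (restrictLp hf s),
      (memLp_indicator_of_continuous hf t).coeFn_toLp,
      (memLp_indicator_of_continuous hf s).coeFn_toLp] with x e1 e2 e3
    rw [e1, Pi.sub_apply, restrictLp, restrictLp, e2, e3]
    have h0 : (0 : ℝ) ≤ s := NNReal.coe_nonneg _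
    simp only [Set.indicator, Set.mem_Ioc]
    rcases le_or_gt x s with hx | hx
    · simp [hx, hx.trans hst', hx.not_gt]
    · by_cases hx2 : x ≤ t <;> simp [hx, hx.not_ge, h0.trans_lt hx, hx2, hc, abs_of_nonneg hc0]
  rw [Lp.norm_def, h1, eLpNorm_indicator_const measurableSet_Ioc (by norm_num) (by norm_num)]
  simp only [Real.volume_Ioc, ENNReal.toReal_mul, toReal_enorm, mul_pow, Real.norm_eq_abs, sq_abs]
  rw [← ENNReal.toReal_rpow, ENNReal.toReal_ofReal (by linarith), ENNReal.toReal_ofNat,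
    ← Real.sqrt_eq_rpow, Real.sq_sqrt (by linarith)]
  ring

end WienerIntegral

/-! ### The Fourier modes of the stochastic convolution -/

section Modes

lemma propagatorSymbol_add (s t : ℝ) (n : ℤ) :
    propagatorSymbol (s + t) n = propagatorSymbol s n * propagatorSymbol t n := by
  rw [propagatorSymbol, propagatorSymbol, propagatorSymbol, ← Complex.exp_add]
  push_cast
  ring_nf

lemma propagatorSymbol_zero (n : ℤ) : propagatorSymbol 0 n = 1 := by simp [propagatorSymbol]

lemma continuous_propagatorSymbol (n : ℤ) : Continuous fun t : ℝ => propagatorSymbol t n := by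
  unfold propagatorSymbol
  fun_prop

lemma continuous_modeIntegrand (n : ℤ) (a : ℂ) (t : ℝ) :
    Continuous fun r : ℝ => propagatorSymbol (t - r) n * a :=
  ((continuous_propagatorSymbol n).comp (continuous_const.sub continuous_id)).mul_const a

variable {Ω : Type*} [MeasurableSpace Ω] {P : Measure Ω} {β : ℤ → ℝ≥0 → Ω → ℂ}

/-- The range of the Wiener integral with respect to a single Brownian motion. -/
def chaos (hβ : IsCylindricalWiener β P) (k : ℤ) : Submodule ℂ (Lp ℂ 2 P) :=
  (gramGraph (hβ.brownian k).toLp timeIndicator).map (LinearMap.fst ℂ _ _)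

/-- Places every Wiener integral in the space where the Gaussian moment bounds hold. -/
lemma chaos_le (hβ : IsCylindricalWiener β P) (k : ℤ) :
    chaos hβ k ≤ (chaosSpan hβ).topologicalClosure := by
  rintro _ ⟨z, hz, rfl⟩
  refine Submodule.topologicalClosure_mono (Submodule.span_mono ?_) (fst_mem_closure_span hz)
  rintro _ ⟨t, rfl⟩
  exact ⟨(k, t), rfl⟩

variable [IsProbabilityMeasure P]

lemma orthogonalFamily_chaos (hβ : IsCylindricalWiener β P) :
    OrthogonalFamily ℂ (fun k => chaos hβ k) fun k => (chaos hβ k).subtypeₗᵢ := by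
  rintro k l hkl ⟨_, z, hz, rfl⟩ ⟨_, z', hz', rfl⟩
  exact inner_eq_zero_of_mem_gramGraph (fun s t => hβ.inner_toLp_of_ne hkl s t) hz hz'

/-- The process `M(t) = ∑_k ∫_0^t σ(-r) a_k dβ_k(r)`, where `σ(t)` is the symbol of the propagator
at the frequency `n`. -/
theorem exists_modeProcess (hβ : IsCylindricalWiener β P) (n : ℤ) {a : ℤ → ℂ}
    (ha : Summable fun k => ‖a k‖ ^ 2) :
    ∃ M : ℝ≥0 → Lp ℂ 2 P,
      (∀ t : ℝ≥0, ∃ I : ℤ → Lp ℂ 2 P,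
        (∀ k, IsWienerIntegral (β k) P t (fun r => propagatorSymbol (t - r) n * a k) (I k)) ∧
        HasSum I (propagatorSymbol t n • M t)) ∧
      M 0 = 0 ∧
      ∀ s t : ℝ≥0, s ≤ t → M t - M s ∈ (chaosSpan hβ).topologicalClosure ∧
        ‖M t - M s‖ ^ 2 ≤ (t - s) * ∑' k, ‖a k‖ ^ 2 := by
  have hf : ∀ k, Continuous fun r : ℝ => propagatorSymbol (-r) n * a k := fun k => by
    simpa using continuous_modeIntegrand n (a k) 0
  have hσ : ∀ t : ℝ, propagatorSymbol (-t) n * propagatorSymbol t n = 1 := fun t => by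
    rw [← propagatorSymbol_add, neg_add_cancel, propagatorSymbol_zero]
  choose I hI hIg using fun (t : ℝ≥0) (k : ℤ) =>
    exists_isWienerIntegral (hβ.brownian k) (continuous_modeIntegrand n (a k) t) t
  -- Removing the phase turns the integrand into `σ(-r) a_k`, the same for all `t`, so that
  -- increments in `t` become integrals over `(s, t]`.
  let J : ℝ≥0 → ℤ → Lp ℂ 2 P := fun t k => propagatorSymbol (-t) n • I t k
  have hJ : ∀ t k, (J t k, restrictLp (hf k) t)
      ∈ gramGraph (hβ.brownian k).toLp timeIndicator := fun t k => by
    have h1 := Submodule.smul_mem _ (propagatorSymbol (-t) n) (hIg t k)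
    convert h1 using 1
    have h2 := restrictLp_eq_smul (hf k) (continuous_modeIntegrand n (a k) t)
      (c := propagatorSymbol (-t) n) (fun r => by
        rw [← mul_assoc, ← propagatorSymbol_add]
        ring_nf) t
    exact Prod.ext rfl h2
  have hJd : ∀ s t k, J t k - J s k ∈ chaos hβ k := fun s t k =>
    ⟨_, Submodule.sub_mem _ (hJ t k) (hJ s k), rfl⟩
  have hJn : ∀ s t : ℝ≥0, s ≤ t → ∀ k, ‖J t k - J s k‖ ^ 2 = (t - s) * ‖a k‖ ^ 2 := by
    intro s t hst k
    have h1 := norm_eq_of_mem_gramGraph (hβ.brownian k).inner_toLp_eq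
      (Submodule.sub_mem _ (hJ t k) (hJ s k))
    simp only [Prod.fst_sub, Prod.snd_sub] at h1
    rw [h1, norm_restrictLp_sub (hf k) (c := ‖a k‖) (fun r => by
      rw [norm_mul, norm_propagatorSymbol, one_mul]) hst]
  have hJ0 : ∀ k, J 0 k = 0 := fun k => by
    have h1 := norm_eq_of_mem_gramGraph (hβ.brownian k).inner_toLp_eq (hJ 0 k)
    simpa [restrictLp_zero] using h1
  have hsum : ∀ t, Summable (J t) := fun t => by
    -- Terms with different `k` are orthogonal, so square summability of the norms is enough.
    have h1 := (orthogonalFamily_chaos hβ).summable_iff_norm_sq_summable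
      (fun k => ⟨J t k - J 0 k, hJd 0 t k⟩)
    have h2 : Summable fun k => ‖J t k - J 0 k‖ ^ 2 := by
      simp only [hJn 0 t zero_le]
      exact ha.mul_left _
    simpa [hJ0] using h1.mpr h2
  refine ⟨fun t => ∑' k, J t k, fun t => ⟨I t, hI t, ?_⟩, by simp [hJ0], fun s t hst => ?_⟩
  · have h1 := (hsum t).hasSum.const_smul (propagatorSymbol t n)
    convert h1 using 1
    funext k
    simp only [J]
    rw [smul_smul, mul_comm, hσ, one_smul]
  · have h1 : HasSum (fun k => J t k - J s k) (∑' k, J t k - ∑' k, J s k) :=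
      (hsum t).hasSum.sub (hsum s).hasSum
    constructor
    · exact (Submodule.isClosed_topologicalClosure _).mem_of_tendsto h1
        (Eventually.of_forall fun F => Submodule.sum_mem _ fun k _ => chaos_le hβ k (hJd s t k))
    · refine le_of_tendsto (h1.norm.pow 2) (Eventually.of_forall fun F => ?_)
      -- Pythagoras on each finite partial sum; the bound then passes to the limit.
      have h2 := (orthogonalFamily_chaos hβ).norm_sum (fun k => ⟨J t k - J s k, hJd s t k⟩) F
      refine (le_of_eq h2).trans ?_
      simp only [Submodule.coe_norm, hJn s t hst]
      rw [← Finset.mul_sum]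
      exact mul_le_mul_of_nonneg_left (ha.sum_le_tsum F fun k _ => by positivity)
        (sub_nonneg.mpr hst)

end Modes

/-! ### Dyadic chaining -/

section Chaining

/-- The dyadic number `i / 2^j`. -/
def dyadic (j i : ℕ) : ℝ≥0 := i / 2 ^ j

lemma dyadic_zero (i : ℕ) : dyadic 0 i = i := by simp [dyadic]

lemma dyadic_succ_two_mul (j i : ℕ) : dyadic (j + 1) (2 * i) = dyadic j i := by
  simp only [dyadic, pow_succ, Nat.cast_mul, Nat.cast_ofNat]
  field_simp

/-- The value of `x` at the largest dyadic number of level `j` below `t`. -/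
def dyadicStep (x : ℝ≥0 → ℂ) (j : ℕ) (t : ℝ≥0) : ℂ := x (dyadic j ⌊t * 2 ^ j⌋₊)

/-- The limit of the values of `x` at the dyadic numbers that approximate `t` from below. -/
def chainLimit (x : ℝ≥0 → ℂ) (t : ℝ≥0) : ℂ := limUnder atTop fun j => dyadicStep x j t

/-- Geometric control of the dyadic increments of `x` on `[0, N]`. -/
structure ChainBound (x : ℝ≥0 → ℂ) (N : ℕ) (R : ℝ) : Prop where
  nonneg : 0 ≤ R
  incr : ∀ j i : ℕ, i < N * 2 ^ j → ‖x (dyadic j (i + 1)) - x (dyadic j i)‖ ≤ R * (5 / 6) ^ j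
  val : ∀ i ≤ N, ‖x i‖ ≤ R

lemma floor_mul_two_pow_lt {N : ℕ} {t : ℝ≥0} (ht : t < N) (j : ℕ) : ⌊t * 2 ^ j⌋₊ < N * 2 ^ j := by
  rw [Nat.floor_lt zero_le]
  push_cast
  gcongr

namespace ChainBound

variable {x : ℝ≥0 → ℂ} {N : ℕ} {R : ℝ} {s t : ℝ≥0}

/-- Refining the grid either keeps the approximating point or moves it by one step of level `j + 1`,
since `⌊2y⌋` is `2⌊y⌋` or `2⌊y⌋ + 1`. -/
lemma dist_dyadicStep_succ (h : ChainBound x N R) (ht : t < N) (j : ℕ) :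
    dist (dyadicStep x j t) (dyadicStep x (j + 1) t) ≤ R * (5 / 6) ^ j := by
  set m := ⌊t * 2 ^ j⌋₊ with hm
  have h1 : 2 * m ≤ ⌊t * 2 ^ (j + 1)⌋₊ := by
    rw [Nat.le_floor_iff zero_le]
    have := Nat.floor_le (zero_le (a := t * 2 ^ j))
    push_cast
    calc (2 : ℝ≥0) * m ≤ 2 * (t * 2 ^ j) := by gcongr
      _ = t * 2 ^ (j + 1) := by ring
  have h2 : ⌊t * 2 ^ (j + 1)⌋₊ < 2 * m + 2 := by
    rw [Nat.floor_lt zero_le]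
    have := Nat.lt_floor_add_one (t * 2 ^ j)
    push_cast
    calc t * 2 ^ (j + 1) = 2 * (t * 2 ^ j) := by ring
      _ < 2 * (m + 1) := by gcongr
      _ = 2 * m + 2 := by ring
  have h3 := floor_mul_two_pow_lt ht (j + 1)
  have hR := h.nonneg
  obtain h4 | h4 : ⌊t * 2 ^ (j + 1)⌋₊ = 2 * m ∨ ⌊t * 2 ^ (j + 1)⌋₊ = 2 * m + 1 := by omega
  · rw [dyadicStep, dyadicStep, h4, dyadic_succ_two_mul, dist_self]
    positivity
  · rw [dyadicStep, dyadicStep, h4, ← hm, ← dyadic_succ_two_mul, dist_comm, dist_eq_norm]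
    refine (h.incr (j + 1) (2 * m) (by omega)).trans ?_
    gcongr R * ?_
    exact pow_le_pow_of_le_one (by norm_num) (by norm_num) (Nat.le_succ j)

lemma tendsto_dyadicStep (h : ChainBound x N R) (ht : t < N) :
    Tendsto (fun j => dyadicStep x j t) atTop (𝓝 (chainLimit x t)) :=
  tendsto_nhds_limUnder (cauchySeq_tendsto_of_complete
    (cauchySeq_of_le_geometric _ _ (by norm_num) (h.dist_dyadicStep_succ ht)))

/-- The factor 6 is the geometric sum `1 / (1 - 5/6)`. The later constants are `7 = 6 + 1` and `13 =
6 + 6 + 1`, the extra 1 coming from an integer value and from a single dyadic increment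
respectively. -/
lemma dist_dyadicStep_chainLimit (h : ChainBound x N R) (ht : t < N) (j : ℕ) :
    dist (dyadicStep x j t) (chainLimit x t) ≤ 6 * (R * (5 / 6) ^ j) := by
  refine (dist_le_of_le_geometric_of_tendsto _ _ (by norm_num) (h.dist_dyadicStep_succ ht)
    (h.tendsto_dyadicStep ht) j).trans (le_of_eq ?_)
  ring

lemma norm_chainLimit_le (h : ChainBound x N R) (ht : t < N) : ‖chainLimit x t‖ ≤ 7 * R := by
  have h1 := h.dist_dyadicStep_chainLimit ht 0
  have h2 : ‖dyadicStep x 0 t‖ ≤ R := by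
    have := floor_mul_two_pow_lt ht 0
    simp only [pow_zero, mul_one] at this
    simp only [dyadicStep, dyadic_zero, pow_zero, mul_one]
    exact h.val _ this.le
  rw [dist_eq_norm, norm_sub_rev] at h1
  have h3 := norm_sub_norm_le (chainLimit x t) (dyadicStep x 0 t)
  simp only [pow_zero, mul_one] at h1
  linarith

lemma dist_chainLimit_le (h : ChainBound x N R) (hst : s ≤ t) (ht : t < N) {j : ℕ}
    (hj : t * 2 ^ j ≤ s * 2 ^ j + 1) :
    dist (chainLimit x s) (chainLimit x t) ≤ 13 * (R * (5 / 6) ^ j) := by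
  have h1 := h.dist_dyadicStep_chainLimit ht j
  have h2 := h.dist_dyadicStep_chainLimit (hst.trans_lt ht) j
  have h3 : dist (dyadicStep x j s) (dyadicStep x j t) ≤ R * (5 / 6) ^ j := by
    have e1 : ⌊s * 2 ^ j⌋₊ ≤ ⌊t * 2 ^ j⌋₊ := Nat.floor_mono (by gcongr)
    have e2 : ⌊t * 2 ^ j⌋₊ ≤ ⌊s * 2 ^ j⌋₊ + 1 := by
      rw [← Nat.floor_add_one zero_le]
      exact Nat.floor_mono hj
    have hR := h.nonneg
    obtain e3 | e3 : ⌊t * 2 ^ j⌋₊ = ⌊s * 2 ^ j⌋₊ ∨ ⌊t * 2 ^ j⌋₊ = ⌊s * 2 ^ j⌋₊ + 1 := by omega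
    · rw [dyadicStep, dyadicStep, e3, dist_self]
      positivity
    · rw [dyadicStep, dyadicStep, e3, dist_comm, dist_eq_norm]
      exact h.incr _ _ (floor_mul_two_pow_lt (hst.trans_lt ht) j)
  have h4 := dist_triangle4 (chainLimit x s) (dyadicStep x j s) (dyadicStep x j t)
    (chainLimit x t)
  rw [dist_comm] at h2
  linarith

lemma continuousOn_chainLimit (h : ChainBound x N R) :
    ContinuousOn (chainLimit x) (Set.Iio (N : ℝ≥0)) := by
  have hlim : Tendsto (fun j : ℕ => 13 * (R * (5 / 6 : ℝ) ^ j)) atTop (𝓝 0) := by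
    have := ((tendsto_pow_atTop_nhds_zero_of_lt_one (r := (5 / 6 : ℝ)) (by norm_num)
      (by norm_num)).const_mul R).const_mul 13
    simpa using this
  rw [Metric.continuousOn_iff]
  intro t ht ε hε
  obtain ⟨j, hj⟩ := (hlim.eventually (gt_mem_nhds hε)).exists
  -- Points closer than one mesh width of level `j` have floors differing by at most one, as
  -- `dist_chainLimit_le` needs.
  refine ⟨(1 / 2) ^ j, by positivity, fun s hs hst => ?_⟩
  rw [NNReal.dist_eq] at hst
  have key : ∀ u v : ℝ≥0, (v : ℝ) - u ≤ (1 / 2) ^ j → v * 2 ^ j ≤ u * 2 ^ j + 1 := by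
    intro u v huv
    rw [← NNReal.coe_le_coe]
    push_cast
    have h2 : (0 : ℝ) < 2 ^ j := by positivity
    have h3 : (1 / 2 : ℝ) ^ j * 2 ^ j = 1 := by rw [← mul_pow]; norm_num
    nlinarith
  rcases le_total s t with hle | hle
  · refine (h.dist_chainLimit_le hle ht (key _ _ ?_)).trans_lt hj
    have := neg_le_abs ((s : ℝ) - t)
    linarith
  · rw [dist_comm]
    refine (h.dist_chainLimit_le hle hs (key _ _ ?_)).trans_lt hj
    have := le_abs_self ((s : ℝ) - t)
    linarith

end ChainBound

/-- A weighted sum of the `q`-th powers of the dyadic increments of `x` on `[0, N]`. -/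
def chainEnergy (q N : ℕ) (x : ℝ≥0 → ℂ) : ℝ≥0∞ :=
  ∑' j : ℕ, (6 / 5 : ℝ≥0∞) ^ (j * q) *
      ∑ i ∈ Finset.range (N * 2 ^ j), ‖x (dyadic j (i + 1)) - x (dyadic j i)‖ₑ ^ q
    + ∑ i ∈ Finset.range (N + 1), ‖x i‖ₑ ^ q

/-- The modulus of continuity obtained from the chaining energy. -/
def chainRadius (q N : ℕ) (x : ℝ≥0 → ℂ) : ℝ := (chainEnergy q N x ^ (1 / q : ℝ)).toReal

lemma le_chainRadius {q N : ℕ} (hq : q ≠ 0) {x : ℝ≥0 → ℂ} (h : chainEnergy q N x ≠ ∞) {z : ℝ}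
    (hz : ENNReal.ofReal z ^ q ≤ chainEnergy q N x) : z ≤ chainRadius q N x := by
  have hq' : (0 : ℝ) < q := by positivity
  have h1 := ENNReal.rpow_le_rpow hz (show (0 : ℝ) ≤ 1 / q by positivity)
  rw [← ENNReal.rpow_natCast, ← ENNReal.rpow_mul, mul_one_div_cancel hq'.ne',
    ENNReal.rpow_one] at h1
  exact (ENNReal.ofReal_le_iff_le_toReal (ENNReal.rpow_ne_top_of_nonneg (by positivity) h)).mp h1

/-- Each increment and each integer value is a single term of the energy; the weight `(6/5) ^ (j *
q)` becomes the decay `(5/6) ^ j` after taking the `q`-th root. -/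
lemma chainBound_chainRadius {q N : ℕ} (hq : q ≠ 0) {x : ℝ≥0 → ℂ} (h : chainEnergy q N x ≠ ∞) :
    ChainBound x N (chainRadius q N x) where
  nonneg := ENNReal.toReal_nonneg
  incr j i hi := by
    have h1 : ‖x (dyadic j (i + 1)) - x (dyadic j i)‖ * (6 / 5) ^ j ≤ chainRadius q N x := by
      refine le_chainRadius hq h ?_
      rw [ENNReal.ofReal_mul (norm_nonneg _), ofReal_norm, mul_pow, mul_comm,
        ENNReal.ofReal_pow (by norm_num), ← pow_mul]
      have h65 : ENNReal.ofReal (6 / 5) = 6 / 5 := by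
        rw [ENNReal.ofReal_div_of_pos (by norm_num)]; norm_num
      rw [h65]
      refine le_trans ?_ le_self_add
      refine le_trans ?_ (ENNReal.le_tsum j)
      gcongr
      exact Finset.single_le_sum
        (f := fun i => ‖x (dyadic j (i + 1)) - x (dyadic j i)‖ₑ ^ q) (fun _ _ => zero_le)
        (Finset.mem_range.mpr hi)
    have h2 : (6 / 5 : ℝ) ^ j * (5 / 6) ^ j = 1 := by rw [← mul_pow]; norm_num
    calc _ = ‖x (dyadic j (i + 1)) - x (dyadic j i)‖ * (6 / 5) ^ j * (5 / 6) ^ j := by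
          rw [mul_assoc, h2, mul_one]
      _ ≤ _ := by gcongr
  val i hi := by
    refine le_chainRadius hq h ?_
    rw [ofReal_norm]
    refine le_trans ?_ le_add_self
    exact Finset.single_le_sum (f := fun i : ℕ => ‖x i‖ₑ ^ q) (fun _ _ => zero_le)
      (Finset.mem_range.mpr (by omega))

variable {Ω : Type*} [MeasurableSpace Ω] {P : Measure Ω} {X : ℝ≥0 → Ω → ℂ}

lemma aemeasurable_chainEnergy (hX : ∀ t, AEStronglyMeasurable (X t) P) (q N : ℕ) :
    AEMeasurable (fun ω => chainEnergy q N fun t => X t ω) P := by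
  have h1 : ∀ s t, AEMeasurable (fun ω => ‖X t ω - X s ω‖ₑ ^ q) P := fun s t =>
    ((hX t).sub (hX s)).enorm.pow_const q
  have h2 : ∀ t, AEMeasurable (fun ω => ‖X t ω‖ₑ ^ q) P := fun t => (hX t).enorm.pow_const q
  exact (AEMeasurable.tsum fun j => (Finset.aemeasurable_fun_sum _ fun i _ =>
    h1 _ _).const_mul _).add (Finset.aemeasurable_fun_sum _ fun i _ => h2 _)

/-- The constant in the bound of the expected chaining energy. -/
def chainConst (m N : ℕ) : ℝ≥0∞ :=
  ∑' j : ℕ, (6 / 5 : ℝ≥0∞) ^ (j * (2 * m)) * ((N * 2 ^ j : ℕ) * (((2 : ℝ≥0∞) ^ j)⁻¹) ^ m)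
    + ∑ i ∈ Finset.range (N + 1), (i : ℝ≥0∞) ^ m

/-- Level `j` has `N * 2 ^ j` increments of moment `2 ^ (-jm)`, so with the weights the series is
geometric of ratio `2 (18/25)^m`, where `18/25 = (6/5)² / 2`. The ratio is below 1 for `m = 3` but
not for `m = 2`. -/
lemma chainConst_ne_top {m : ℕ} (hm : 3 ≤ m) (N : ℕ) : chainConst m N ≠ ∞ := by
  refine ENNReal.add_ne_top.mpr ⟨?_, ENNReal.sum_ne_top.mpr fun i _ =>
    ENNReal.pow_ne_top (ENNReal.natCast_ne_top i)⟩
  have h1 : ∀ j : ℕ, (6 / 5 : ℝ≥0∞) ^ (j * (2 * m)) *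
      ((N * 2 ^ j : ℕ) * (((2 : ℝ≥0∞) ^ j)⁻¹) ^ m)
      = ((N * (2 * (18 / 25) ^ m) ^ j : ℝ≥0) : ℝ≥0∞) := fun j => by
    have e1 : (6 / 5 : ℝ≥0∞) = ((6 / 5 : ℝ≥0) : ℝ≥0∞) := by
      rw [ENNReal.coe_div (by norm_num)]; norm_num
    have e2 : ((2 : ℝ≥0∞) ^ j)⁻¹ = (((2 : ℝ≥0) ^ j)⁻¹ : ℝ≥0) := by
      rw [ENNReal.coe_inv (by positivity)]; norm_num
    rw [e1, e2]
    norm_cast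
    push_cast
    rw [show (18 / 25 : ℝ≥0) = (6 / 5) ^ 2 * 2⁻¹ by norm_num]
    simp only [mul_pow, inv_pow, ← pow_mul]
    ring
  simp only [h1]
  rw [ENNReal.tsum_coe_ne_top_iff_summable]
  refine Summable.mul_left _ (NNReal.summable_geometric ?_)
  calc 2 * (18 / 25 : ℝ≥0) ^ m ≤ 2 * (18 / 25) ^ 3 := by
        gcongr 2 * ?_
        exact pow_le_pow_of_le_one (by norm_num) (by rw [div_le_one (by norm_num)]; norm_num) hm
    _ < 1 := by norm_num

lemma lintegral_chainEnergy_le (hX : ∀ t, AEStronglyMeasurable (X t) P) {m N : ℕ} {K : ℝ≥0∞}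
    (h0 : ∀ t : ℝ≥0, ∫⁻ ω, ‖X t ω‖ₑ ^ (2 * m) ∂P ≤ K * (t : ℝ≥0∞) ^ m)
    (hK : ∀ s t : ℝ≥0, s ≤ t →
      ∫⁻ ω, ‖X t ω - X s ω‖ₑ ^ (2 * m) ∂P ≤ K * ((t - s : ℝ≥0) : ℝ≥0∞) ^ m) :
    ∫⁻ ω, chainEnergy (2 * m) N (fun t => X t ω) ∂P ≤ K * chainConst m N := by
  have h1 : ∀ s t, AEMeasurable (fun ω => ‖X t ω - X s ω‖ₑ ^ (2 * m)) P := fun s t =>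
    ((hX t).sub (hX s)).enorm.pow_const _
  have h2 : ∀ t, AEMeasurable (fun ω => ‖X t ω‖ₑ ^ (2 * m)) P := fun t =>
    (hX t).enorm.pow_const _
  have h3 : ∀ j i : ℕ, ∫⁻ ω, ‖X (dyadic j (i + 1)) ω - X (dyadic j i) ω‖ₑ ^ (2 * m) ∂P
      ≤ K * (((2 : ℝ≥0∞) ^ j)⁻¹) ^ m := fun j i => by
    have e1 : dyadic j (i + 1) = dyadic j i + (2 ^ j)⁻¹ := by
      simp only [dyadic]; push_cast; ring
    refine (hK _ _ (by rw [e1]; exact le_self_add)).trans (le_of_eq ?_)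
    rw [e1, add_tsub_cancel_left, ENNReal.coe_inv (by positivity)]
    norm_num
  simp only [chainEnergy]
  rw [lintegral_add_right' _ (Finset.aemeasurable_fun_sum _ fun i _ => h2 _),
    lintegral_tsum (fun j => (Finset.aemeasurable_fun_sum _ fun i _ => h1 _ _).const_mul _),
    lintegral_finsetSum' _ (fun i _ => h2 _), chainConst, mul_add, ← ENNReal.tsum_mul_left,
    Finset.mul_sum]
  refine add_le_add (ENNReal.tsum_le_tsum fun j => ?_) (Finset.sum_le_sum fun i _ => ?_)
  · rw [lintegral_const_mul'' _ (Finset.aemeasurable_fun_sum _ fun i _ => h1 _ _),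
      lintegral_finsetSum' _ (fun i _ => h1 _ _), mul_left_comm K]
    gcongr
    refine (Finset.sum_le_sum fun i _ => h3 j i).trans (le_of_eq ?_)
    rw [Finset.sum_const, Finset.card_range, nsmul_eq_mul]
    ring
  · simpa using h0 i

/-- The dyadic approximations converge almost surely to the chain limit and in the moment of order
`2m` to `X t`; Fatou's lemma identifies the two limits. Thus the continuous process is a
modification of `X` on `[0, N)`. -/
lemma chainLimit_ae_eq (hX : ∀ t, AEStronglyMeasurable (X t) P) {m N : ℕ} (hm : m ≠ 0)
    {K : ℝ≥0∞} (hK' : K ≠ ∞)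
    (hK : ∀ s t : ℝ≥0, s ≤ t →
      ∫⁻ ω, ‖X t ω - X s ω‖ₑ ^ (2 * m) ∂P ≤ K * ((t - s : ℝ≥0) : ℝ≥0∞) ^ m)
    (hE : ∀ᵐ ω ∂P, chainEnergy (2 * m) N (fun t => X t ω) ≠ ∞) {t : ℝ≥0} (ht : t < N) :
    ∀ᵐ ω ∂P, chainLimit (fun t => X t ω) t = X t ω := by
  have hlim : ∀ᵐ ω ∂P, Tendsto (fun j => ‖X t ω - dyadicStep (fun t => X t ω) j t‖ₑ ^ (2 * m))
      atTop (𝓝 (‖X t ω - chainLimit (fun t => X t ω) t‖ₑ ^ (2 * m))) := by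
    filter_upwards [hE] with ω hω
    have h1 := (chainBound_chainRadius (by omega) hω).tendsto_dyadicStep ht
    exact ((ENNReal.continuous_pow _).tendsto _).comp
      ((continuous_enorm.tendsto _).comp (tendsto_const_nhds.sub h1))
  have hb : ∀ j, ∫⁻ ω, ‖X t ω - dyadicStep (fun t => X t ω) j t‖ₑ ^ (2 * m) ∂P
      ≤ K * ((2⁻¹ ^ j : ℝ≥0) : ℝ≥0∞) ^ m := fun j => by
    have e1 : dyadic j ⌊t * 2 ^ j⌋₊ ≤ t := by
      rw [dyadic, div_le_iff₀ (by positivity)]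
      exact Nat.floor_le zero_le
    refine (hK _ _ e1).trans ?_
    gcongr
    rw [tsub_le_iff_left, dyadic, inv_pow, ← one_div, ← add_div, le_div_iff₀ (by positivity)]
    exact (Nat.lt_floor_add_one _).le
  have hz : Tendsto (fun j => K * ((2⁻¹ ^ j : ℝ≥0) : ℝ≥0∞) ^ m) atTop (𝓝 0) := by
    have h1 : Tendsto (fun j => ((2⁻¹ ^ j : ℝ≥0) : ℝ≥0∞)) atTop (𝓝 ((0 : ℝ≥0) : ℝ≥0∞)) :=
      ENNReal.tendsto_coe.mpr (NNReal.tendsto_pow_atTop_nhds_zero_of_lt_one (by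
        rw [inv_lt_one₀ (by norm_num)]; norm_num))
    have h2 := ENNReal.Tendsto.const_mul ((ENNReal.continuous_pow m).tendsto _ |>.comp h1)
      (Or.inr hK')
    simpa [hm] using h2
  have hmeas : ∀ j, AEMeasurable
      (fun ω => ‖X t ω - dyadicStep (fun t => X t ω) j t‖ₑ ^ (2 * m)) P := fun j =>
    ((hX _).sub (hX _)).enorm.pow_const _
  have h0 : ∫⁻ ω, ‖X t ω - chainLimit (fun t => X t ω) t‖ₑ ^ (2 * m) ∂P = 0 := by
    refine le_antisymm ?_ zero_le
    calc _ = ∫⁻ ω, liminf (fun j => ‖X t ω - dyadicStep (fun t => X t ω) j t‖ₑ ^ (2 * m)) atTop ∂P :=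
          lintegral_congr_ae (hlim.mono fun ω h => h.liminf_eq.symm)
      _ ≤ liminf (fun j => ∫⁻ ω, ‖X t ω - dyadicStep (fun t => X t ω) j t‖ₑ ^ (2 * m) ∂P) atTop :=
          lintegral_liminf_le' hmeas
      _ ≤ liminf (fun j => K * ((2⁻¹ ^ j : ℝ≥0) : ℝ≥0∞) ^ m) atTop :=
          liminf_le_liminf (Eventually.of_forall hb)
      _ = 0 := hz.liminf_eq
  rw [lintegral_eq_zero_iff' (aemeasurable_of_tendsto_metrizable_ae atTop hmeas hlim)] at h0
  filter_upwards [h0] with ω hω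
  have : ‖X t ω - chainLimit (fun t => X t ω) t‖ₑ = 0 := by
    simpa [hm] using hω
  exact (sub_eq_zero.mp (enorm_eq_zero.mp this)).symm

end Chaining

/-! ### Identification of the Fourier-Lebesgue space with `ℓ^p` -/

section FLIso

lemma one_le_bracket (n : ℤ) : 1 ≤ bracket n := by
  rw [bracket, Real.one_le_sqrt]
  nlinarith [sq_nonneg (n : ℝ)]

lemma bracket_le (n : ℤ) : bracket n ≤ 1 + |(n : ℝ)| := by
  rw [bracket, Real.sqrt_le_left (by positivity)]
  nlinarith [sq_abs (n : ℝ), abs_nonneg (n : ℝ)]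

variable {s : ℝ} {p : ℝ≥0∞}

lemma FL_ext {u v : FL s p} (h : ∀ n, coeff u n = coeff v n) : u = v := by
  refine weightedCoeffLp_injective s p (Subtype.ext (funext fun n => ?_))
  change ((bracket n ^ s : ℝ) : ℂ) * coeff u n = ((bracket n ^ s : ℝ) : ℂ) * coeff v n
  rw [h]

variable [Fact (1 ≤ p)]

lemma polyGrowth_lp (s : ℝ) (x : lp (fun _ : ℤ => ℂ) p) :
    PolyGrowth fun n => ((bracket n ^ (-s) : ℝ) : ℂ) * x n := by
  refine ⟨‖x‖, ⌈|s|⌉₊, fun n => ?_⟩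
  have hp : p ≠ 0 := (zero_lt_one.trans_le Fact.out).ne'
  rw [norm_mul, mul_comm, Complex.norm_real,
    Real.norm_of_nonneg (Real.rpow_nonneg (bracket_pos n).le _)]
  refine mul_le_mul (lp.norm_apply_le_norm hp x n) ?_ (Real.rpow_nonneg (bracket_pos n).le _)
    (norm_nonneg _)
  · calc bracket n ^ (-s) ≤ bracket n ^ (⌈|s|⌉₊ : ℝ) :=
          Real.rpow_le_rpow_of_exponent_le (one_le_bracket n)
            ((neg_le_abs s).trans (Nat.le_ceil _))
      _ = bracket n ^ ⌈|s|⌉₊ := Real.rpow_natCast _ _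
      _ ≤ _ := pow_le_pow_left₀ (bracket_pos n).le (bracket_le n) _

lemma bracket_rpow_mul_neg (s : ℝ) (n : ℤ) :
    ((bracket n ^ s : ℝ) : ℂ) * ((bracket n ^ (-s) : ℝ) : ℂ) = 1 := by
  rw [← Complex.ofReal_mul, ← Real.rpow_add (bracket_pos n), add_neg_cancel, Real.rpow_zero,
    Complex.ofReal_one]

lemma weightedCoeff_ofCoeff_lp (s : ℝ) (x : lp (fun _ : ℤ => ℂ) p) :
    weightedCoeff s (ofCoeff _ (polyGrowth_lp s x)) = x := by
  funext n
  rw [weightedCoeff, coeff_ofCoeff, ← mul_assoc, bracket_rpow_mul_neg, one_mul]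

/-- The element of `𝓕L^{s,p}` with given weighted Fourier coefficients in `ℓ^p`. -/
def ofLp (s : ℝ) (x : lp (fun _ : ℤ => ℂ) p) : FL s p :=
  ⟨ofCoeff _ (polyGrowth_lp s x), by
    change Memℓp _ p
    rw [weightedCoeff_ofCoeff_lp]
    exact lp.memℓp x⟩

lemma weightedCoeffLp_ofLp (x : lp (fun _ : ℤ => ℂ) p) :
    weightedCoeffLp s p (ofLp s x) = x :=
  Subtype.ext (weightedCoeff_ofCoeff_lp s x)

lemma coeff_ofLp (x : lp (fun _ : ℤ => ℂ) p) (n : ℤ) :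
    coeff (ofLp s x) n = ((bracket n ^ (-s) : ℝ) : ℂ) * x n :=
  coeff_ofCoeff _ (polyGrowth_lp s x) n

lemma norm_weightedCoeffLp (u : FL s p) : ‖weightedCoeffLp s p u‖ = ‖u‖ := rfl

lemma isometry_weightedCoeffLp : Isometry (weightedCoeffLp s p) :=
  AddMonoidHomClass.isometry_of_norm _ norm_weightedCoeffLp

/-- Lets continuity and measurability be proved in `ℓ^p` and transported to `FL s p`. -/
lemma isometry_ofLp : Isometry (ofLp (p := p) s) :=
  isometry_weightedCoeffLp.right_inv weightedCoeffLp_ofLp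

lemma continuous_coeff (n : ℤ) : Continuous fun u : FL s p => coeff u n := by
  have h1 : Continuous fun u : FL s p => weightedCoeffLp s p u n :=
    ((continuous_apply n).comp lp.uniformContinuous_coe.continuous).comp
      isometry_weightedCoeffLp.continuous
  have h2 : (fun u : FL s p => coeff u n)
      = fun u : FL s p => ((bracket n ^ (-s) : ℝ) : ℂ) * weightedCoeffLp s p u n := by
    funext u
    change _ = ((bracket n ^ (-s) : ℝ) : ℂ) * (((bracket n ^ s : ℝ) : ℂ) * coeff u n)
    rw [← mul_assoc, mul_comm ((bracket n ^ (-s) : ℝ) : ℂ), bracket_rpow_mul_neg, one_mul]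
  rw [h2]
  exact continuous_const.mul h1

/-- A curve in `ℓ^p` is continuous if its coordinates are continuous and it is dominated by a fixed
element of `ℓ^p`. -/
lemma continuousOn_lp_of_dominated {T : Type*} [TopologicalSpace T] (hp : p ≠ ∞) {S : Set T}
    {f : T → lp (fun _ : ℤ => ℂ) p} {g : ℤ → ℝ} (hg : Summable fun n => g n ^ p.toReal)
    (hf : ∀ n, ContinuousOn (fun t => f t n) S) (hfg : ∀ t ∈ S, ∀ n, ‖f t n‖ ≤ g n) :
    ContinuousOn f S := by
  have hp0 : 0 < p.toReal := ENNReal.toReal_pos (zero_lt_one.trans_le Fact.out).ne' hp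
  intro t₀ ht₀
  rw [ContinuousWithinAt, tendsto_iff_norm_sub_tendsto_zero]
  have h1 : Tendsto (fun t => ∑' n, ‖f t n - f t₀ n‖ ^ p.toReal) (𝓝[S] t₀)
      (𝓝 (∑' _ : ℤ, (0 : ℝ))) := by
    refine tendsto_tsum_of_dominated_convergence (bound := fun n => (2 : ℝ) ^ p.toReal *
      g n ^ p.toReal) (hg.mul_left _) (fun n => ?_) ?_
    · have h2 : Tendsto (fun t => ‖f t n - f t₀ n‖) (𝓝[S] t₀) (𝓝 0) :=
        tendsto_iff_norm_sub_tendsto_zero.mp (hf n t₀ ht₀)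
      have h3 := h2.rpow_const (p := p.toReal) (Or.inr hp0.le)
      rwa [Real.zero_rpow hp0.ne'] at h3
    · filter_upwards [self_mem_nhdsWithin] with t ht n
      have h0 : 0 ≤ g n := (norm_nonneg _).trans (hfg t ht n)
      rw [Real.norm_of_nonneg (by positivity), ← Real.mul_rpow (by norm_num) h0]
      gcongr
      calc _ ≤ ‖f t n‖ + ‖f t₀ n‖ := norm_sub_le _ _
        _ ≤ 2 * g n := by linarith [hfg t ht n, hfg t₀ ht₀ n]
  have h4 := h1.rpow_const (p := 1 / p.toReal) (Or.inr (by positivity))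
  rw [tsum_zero, Real.zero_rpow (by positivity)] at h4
  refine h4.congr fun t => ?_
  rw [lp.norm_eq_tsum_rpow hp0]
  rfl

/-- For `p < ∞` an element of `ℓ^p` is the limit of its finite truncations, which are measurable as
soon as the coordinates are. -/
lemma aestronglyMeasurable_lp {Ω : Type*} [MeasurableSpace Ω] {P : Measure Ω} (hp : p ≠ ∞)
    {Z : Ω → lp (fun _ : ℤ => ℂ) p} (hZ : ∀ n, AEStronglyMeasurable (fun ω => Z ω n) P) :
    AEStronglyMeasurable Z P := by
  refine aestronglyMeasurable_of_tendsto_ae (atTop : Filter (Finset ℤ))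
    (f := fun F ω => ∑ n ∈ F, lp.single p n (Z ω n)) (fun F => ?_)
    (ae_of_all _ fun ω => lp.hasSum_single hp (Z ω))
  exact Finset.aestronglyMeasurable_fun_sum F fun n _ =>
    (lp.singleContinuousLinearMap ℂ (fun _ : ℤ => ℂ) p n).continuous.comp_aestronglyMeasurable (hZ n)

end FLIso

/-! ### Continuous paths in the Fourier-Lebesgue space -/

section Paths

variable {p : ℝ≥0∞} [Fact (1 ≤ p)] {w : ℤ → ℝ}

lemma toReal_pos_of_fact (hp : p ≠ ∞) : 0 < p.toReal :=
  ENNReal.toReal_pos (zero_lt_one.trans_le Fact.out).ne' hp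

/-- The deterministic half of the proof: on `[0, N)` the coordinates are dominated by `7 w_n R_n`,
an `ℓ^p` sequence by hypothesis. Continuity is local, so treating each `N` separately suffices. -/
lemma exists_continuous_path (hp : p ≠ ∞) (hw : ∀ n, 0 < w n) {q : ℕ} (hq : q ≠ 0)
    {x : ℤ → ℝ≥0 → ℂ}
    (hx : ∀ N : ℕ, ∑' n, (‖w n‖ₑ * chainEnergy q N (x n) ^ (1 / q : ℝ)) ^ p.toReal ≠ ∞) :
    ∃ z : ℝ≥0 → lp (fun _ : ℤ => ℂ) p, Continuous z ∧
      ∀ t n, z t n = (w n : ℂ) * (propagatorSymbol t n * chainLimit (x n) t) := by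
  have hp0 := toReal_pos_of_fact hp
  have hE : ∀ N n, chainEnergy q N (x n) ≠ ∞ := fun N n h => by
    refine ENNReal.ne_top_of_tsum_ne_top (hx N) n ?_
    rw [h, ENNReal.top_rpow_of_pos (by positivity), ENNReal.mul_top (by simpa using (hw n).ne'),
      ENNReal.top_rpow_of_pos hp0]
  have hb : ∀ N n, ChainBound (x n) N (chainRadius q N (x n)) := fun N n =>
    chainBound_chainRadius hq (hE N n)
  have hs : ∀ N : ℕ, Summable fun n => (7 * (w n * chainRadius q N (x n))) ^ p.toReal := fun N => by
    have h1 := (ENNReal.summable_toReal (hx N)).mul_left ((7 : ℝ) ^ p.toReal)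
    refine h1.congr fun n => ?_
    rw [← ENNReal.toReal_rpow, ENNReal.toReal_mul, toReal_enorm, Real.norm_of_nonneg (hw n).le,
      Real.mul_rpow (by norm_num) (mul_nonneg (hw n).le (hb N n).nonneg), chainRadius]
  have hbd : ∀ (N : ℕ) (t : ℝ≥0), t < N → ∀ n,
      ‖(w n : ℂ) * (propagatorSymbol t n * chainLimit (x n) t)‖
        ≤ 7 * (w n * chainRadius q N (x n)) := fun N t ht n => by
    rw [norm_mul, norm_mul, norm_propagatorSymbol, one_mul, Complex.norm_real,
      Real.norm_of_nonneg (hw n).le]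
    have := mul_le_mul_of_nonneg_left ((hb N n).norm_chainLimit_le ht) (hw n).le
    linarith
  have hmem : ∀ t : ℝ≥0,
      Memℓp (fun n => (w n : ℂ) * (propagatorSymbol t n * chainLimit (x n) t)) p := fun t => by
    obtain ⟨N, hN⟩ := exists_nat_gt t
    refine (memℓp_gen_iff hp0).mpr ((hs N).of_nonneg_of_le (fun n => by positivity) fun n => ?_)
    gcongr
    exact hbd N t hN n
  refine ⟨fun t => ⟨_, hmem t⟩, continuous_iff_continuousAt.mpr fun t => ?_, fun t n => rfl⟩
  obtain ⟨N, hN⟩ := exists_nat_gt t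
  refine (continuousOn_lp_of_dominated hp (hs N) (fun n => ?_) fun t ht n => hbd N t ht n).continuousAt
    (Iio_mem_nhds hN)
  exact continuousOn_const.mul (((continuous_propagatorSymbol n).comp
    NNReal.continuous_coe).continuousOn.mul (hb N n).continuousOn_chainLimit)

variable {Ω : Type*} [MeasurableSpace Ω] {P : Measure Ω} [IsProbabilityMeasure P]

lemma lintegral_rpow_le_rpow_lintegral {D : Ω → ℝ≥0∞} (hD : AEMeasurable D P) {r : ℝ} (hr : 0 < r)
    (hr1 : r ≤ 1) : ∫⁻ ω, D ω ^ r ∂P ≤ (∫⁻ ω, D ω ∂P) ^ r := by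
  have h := eLpNorm'_le_eLpNorm'_of_exponent_le hr hr1 P hD.aestronglyMeasurable
  simp only [eLpNorm', enorm_eq_self, ENNReal.rpow_one, one_div, inv_one] at h
  have h2 := ENNReal.rpow_le_rpow h hr.le
  rwa [← ENNReal.rpow_mul, inv_mul_cancel₀ hr.ne', ENNReal.rpow_one] at h2

/-- Almost surely, the chaining energies of the modes are summable. -/
lemma ae_tsum_chainEnergy_ne_top (hp : p ≠ ∞) {m : ℕ} (hm : 3 ≤ m) (hpm : p.toReal ≤ 2 * m)
    {X : ℤ → ℝ≥0 → Ω → ℂ} (hX : ∀ n t, AEStronglyMeasurable (X n t) P) {c : ℝ≥0∞} (hc : c ≠ ∞)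
    {E : ℤ → ℝ≥0∞} (hE : ∑' n, (‖w n‖ₑ * E n ^ (1 / 2 : ℝ)) ^ p.toReal ≠ ∞)
    (h0 : ∀ n (t : ℝ≥0), ∫⁻ ω, ‖X n t ω‖ₑ ^ (2 * m) ∂P ≤ c * E n ^ m * (t : ℝ≥0∞) ^ m)
    (hincr : ∀ n (s t : ℝ≥0), s ≤ t →
      ∫⁻ ω, ‖X n t ω - X n s ω‖ₑ ^ (2 * m) ∂P ≤ c * E n ^ m * ((t - s : ℝ≥0) : ℝ≥0∞) ^ m) :
    ∀ᵐ ω ∂P, ∀ N : ℕ, ∑' n, (‖w n‖ₑ *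
      chainEnergy (2 * m) N (fun t => X n t ω) ^ (1 / (2 * m : ℕ) : ℝ)) ^ p.toReal ≠ ∞ := by
  have hp0 := toReal_pos_of_fact hp
  have hm0 : (0 : ℝ) < m := by positivity
  refine ae_all_iff.mpr fun N => ?_
  have hmeas : ∀ n, AEMeasurable (fun ω => (‖w n‖ₑ *
      chainEnergy (2 * m) N (fun t => X n t ω) ^ (1 / (2 * m : ℕ) : ℝ)) ^ p.toReal) P := fun n =>
    (((aemeasurable_chainEnergy (hX n) _ _).pow_const _).const_mul _).pow_const _
  refine (ae_lt_top' (AEMeasurable.tsum hmeas) (ne_of_lt ?_)).mono fun ω h => h.ne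
  rw [lintegral_tsum hmeas]
  -- Since `r ≤ 1`, Jensen's inequality bounds the expectation of the `r`-th power of the energy;
  -- then `(E n ^ m) ^ r = (E n ^ (1/2)) ^ p` restores the summable γ-norm expression.
  set r : ℝ := p.toReal / (2 * m) with hr
  have hr0 : 0 < r := by positivity
  have hr1 : r ≤ 1 := by rw [hr, div_le_one (by positivity)]; exact hpm
  have key : ∀ n, ∫⁻ ω, (‖w n‖ₑ *
      chainEnergy (2 * m) N (fun t => X n t ω) ^ (1 / (2 * m : ℕ) : ℝ)) ^ p.toReal ∂P
      ≤ (c * chainConst m N) ^ r * (‖w n‖ₑ * E n ^ (1 / 2 : ℝ)) ^ p.toReal := fun n => by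
    have e1 : ∀ ω, (‖w n‖ₑ *
        chainEnergy (2 * m) N (fun t => X n t ω) ^ (1 / (2 * m : ℕ) : ℝ)) ^ p.toReal
        = ‖w n‖ₑ ^ p.toReal * chainEnergy (2 * m) N (fun t => X n t ω) ^ r := fun ω => by
      rw [ENNReal.mul_rpow_of_nonneg _ _ hp0.le, ← ENNReal.rpow_mul]
      congr 2
      rw [hr]; push_cast; ring
    simp only [e1]
    rw [lintegral_const_mul'' _ ((aemeasurable_chainEnergy (hX n) _ _).pow_const _)]
    calc _ ≤ ‖w n‖ₑ ^ p.toReal * (c * E n ^ m * chainConst m N) ^ r := by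
          gcongr
          refine (lintegral_rpow_le_rpow_lintegral (aemeasurable_chainEnergy (hX n) _ _)
            hr0 hr1).trans ?_
          gcongr
          exact lintegral_chainEnergy_le (hX n) (h0 n) (hincr n)
      _ = _ := by
          rw [show c * E n ^ m * chainConst m N = c * chainConst m N * E n ^ m by ring,
            ENNReal.mul_rpow_of_nonneg _ _ hr0.le, ENNReal.mul_rpow_of_nonneg _ _ hp0.le,
            ← ENNReal.rpow_mul, ← ENNReal.rpow_natCast, ← ENNReal.rpow_mul,
            show (m : ℝ) * r = 1 / 2 * p.toReal by rw [hr]; field_simp]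
          ring
  refine (ENNReal.tsum_le_tsum key).trans_lt ?_
  rw [ENNReal.tsum_mul_left]
  exact ENNReal.mul_lt_top (ENNReal.rpow_lt_top_of_nonneg hr0.le
    (ENNReal.mul_ne_top hc (chainConst_ne_top hm N))) hE.lt_top

end Paths

/-! ### The stochastic convolution -/

section Convolution

variable {Ω : Type*} [MeasurableSpace Ω] {P : Measure Ω} [IsProbabilityMeasure P]
  {β : ℤ → ℝ≥0 → Ω → ℂ}

/-- The constant comparing the moment of order `2m` in the first chaos with the variance. -/
def chaosMoment (m : ℕ) : ℝ≥0∞ := (2 * gaussianRatio (2 * m : ℕ)) ^ (2 * m)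

lemma chaosMoment_ne_top (m : ℕ) : chaosMoment m ≠ ∞ :=
  ENNReal.pow_ne_top (ENNReal.mul_ne_top (by norm_num)
    (gaussianRatio_ne_top (ENNReal.natCast_ne_top _)))

lemma lintegral_pow_le_of_mem_chaos (hβ : IsCylindricalWiener β P) {X : Lp ℂ 2 P}
    (hX : X ∈ (chaosSpan hβ).topologicalClosure) {m : ℕ} (hm : m ≠ 0) :
    ∫⁻ ω, ‖X ω‖ₑ ^ (2 * m) ∂P ≤ chaosMoment m * ENNReal.ofReal (‖X‖ ^ 2) ^ m := by
  have h1 := eLpNorm_le_of_mem_closure_chaosSpan hβ hX (q := (2 * m : ℕ))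
    (by exact_mod_cast (by omega : 1 ≤ 2 * m)) (ENNReal.natCast_ne_top _)
  have h2 := eLpNorm_nnreal_pow_eq_lintegral (μ := P) (f := X) (p := (2 * m : ℕ))
    (by simpa using hm)
  have h3 : eLpNorm X 2 P = ENNReal.ofReal ‖X‖ := by
    rw [Lp.norm_def, ENNReal.ofReal_toReal (Lp.eLpNorm_ne_top X)]
  simp only [NNReal.coe_natCast, ENNReal.rpow_natCast, ENNReal.coe_natCast] at h2
  rw [← h2, chaosMoment, ENNReal.ofReal_pow (norm_nonneg _), ← h3, ← pow_mul, ← mul_pow]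
  gcongr

/-- The `n`-th Fourier coefficient of the stochastic convolution, up to the phase of the
propagator, with bounds on the moments of its increments. -/
lemma exists_mode_moments (hβ : IsCylindricalWiener β P) (n : ℤ) {a : ℤ → ℂ}
    (ha : ∑' k, ‖a k‖ₑ ^ 2 ≠ ∞) :
    ∃ M : ℝ≥0 → Lp ℂ 2 P,
      (∀ t : ℝ≥0, ∃ I : ℤ → Lp ℂ 2 P,
        (∀ k, IsWienerIntegral (β k) P t (fun r => propagatorSymbol (t - r) n * a k) (I k)) ∧
        HasSum I (propagatorSymbol t n • M t)) ∧
      ∀ m : ℕ, m ≠ 0 →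
        (∀ t : ℝ≥0, ∫⁻ ω, ‖M t ω‖ₑ ^ (2 * m) ∂P
          ≤ chaosMoment m * (∑' k, ‖a k‖ₑ ^ 2) ^ m * (t : ℝ≥0∞) ^ m) ∧
        ∀ s t : ℝ≥0, s ≤ t → ∫⁻ ω, ‖M t ω - M s ω‖ₑ ^ (2 * m) ∂P
          ≤ chaosMoment m * (∑' k, ‖a k‖ₑ ^ 2) ^ m * ((t - s : ℝ≥0) : ℝ≥0∞) ^ m := by
  have hk : ∀ k, (‖a k‖ₑ ^ 2).toReal = ‖a k‖ ^ 2 := fun k => by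
    rw [ENNReal.toReal_pow, toReal_enorm]
  have hs : Summable fun k => ‖a k‖ ^ 2 := by simpa only [hk] using ENNReal.summable_toReal ha
  have hsum : ENNReal.ofReal (∑' k, ‖a k‖ ^ 2) = ∑' k, ‖a k‖ₑ ^ 2 := by
    rw [← ENNReal.ofReal_toReal ha, ENNReal.tsum_toReal_eq (ENNReal.ne_top_of_tsum_ne_top ha)]
    simp only [hk]
  obtain ⟨M, h1, h2, h3⟩ := exists_modeProcess hβ n hs
  have h4 : ∀ m : ℕ, m ≠ 0 → ∀ s t : ℝ≥0, s ≤ t →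
      ∫⁻ ω, ‖(M t - M s : Lp ℂ 2 P) ω‖ₑ ^ (2 * m) ∂P
        ≤ chaosMoment m * (∑' k, ‖a k‖ₑ ^ 2) ^ m * ((t - s : ℝ≥0) : ℝ≥0∞) ^ m := by
    intro m hm s t hst
    refine (lintegral_pow_le_of_mem_chaos hβ (h3 s t hst).1 hm).trans ?_
    rw [mul_assoc, ← mul_pow]
    gcongr
    refine (ENNReal.ofReal_le_ofReal (h3 s t hst).2).trans (le_of_eq ?_)
    rw [← NNReal.coe_sub hst, ENNReal.ofReal_mul (NNReal.coe_nonneg _), hsum, mul_comm,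
      ENNReal.ofReal_coe_nnreal]
  refine ⟨M, h1, fun m hm => ⟨fun t => ?_, fun s t hst => ?_⟩⟩
  · have := h4 m hm 0 t zero_le
    rwa [h2, sub_zero, tsub_zero] at this
  · refine le_trans (le_of_eq (lintegral_congr_ae ?_)) (h4 m hm s t hst)
    filter_upwards [Lp.coeFn_sub (M t) (M s)] with ω hω
    rw [hω, Pi.sub_apply]

variable {s : ℝ} {p : ℝ≥0∞} [Fact (1 ≤ p)] {φ : L2 →L[ℂ] FL s p}

lemma continuous_coeff_propagator (n : ℤ) (u : Distribution) (t : ℝ) :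
    Continuous fun r : ℝ => coeff (propagator (t - r) u) n := by
  simp only [coeff_propagator]
  exact continuous_modeIntegrand n _ t

/-- The stochastic convolution is determined up to modification. -/
lemma IsStochasticConvolution.ae_eq (hβ : IsCylindricalWiener β P) {Ψ Ψ' : ℝ≥0 → Ω → FL s p}
    (h : IsStochasticConvolution φ β P Ψ) (h' : IsStochasticConvolution φ β P Ψ') (t : ℝ≥0) :
    Ψ' t =ᵐ[P] Ψ t := by
  have key : ∀ n, ∀ᵐ ω ∂P, coeff (Ψ' t ω) n = coeff (Ψ t ω) n := fun n => by
    obtain ⟨I, hI, hlim⟩ := (h t).2 n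
    obtain ⟨I', hI', hlim'⟩ := (h' t).2 n
    have hII : ∀ᵐ ω ∂P, ∀ k, I' k ω = I k ω := ae_all_iff.mpr fun k =>
      (hI' k).ae_eq (hβ.brownian k) (continuous_coeff_propagator n _ t) (hI k)
    have hm := (continuous_coeff n).comp_aestronglyMeasurable (h t).1
    have hm' := (continuous_coeff n).comp_aestronglyMeasurable (h' t).1
    have hmI : ∀ F : Finset ℤ, AEStronglyMeasurable (fun ω => ∑ k ∈ F, I k ω) P := fun F =>
      Finset.aestronglyMeasurable_fun_sum F fun k _ => (hI k).1.1
    -- Both coefficients are compared with the same partial sum, whose terms agree almost surely in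
    -- the two versions.
    have hle : ∀ F : Finset ℤ, eLpNorm (fun ω => coeff (Ψ' t ω) n - coeff (Ψ t ω) n) 2 P
        ≤ eLpNorm (fun ω => ∑ k ∈ F, I k ω - coeff (Ψ t ω) n) 2 P
          + eLpNorm (fun ω => ∑ k ∈ F, I' k ω - coeff (Ψ' t ω) n) 2 P := fun F => by
      have e1 : eLpNorm (fun ω => ∑ k ∈ F, I' k ω - coeff (Ψ' t ω) n) 2 P
          = eLpNorm (fun ω => ∑ k ∈ F, I k ω - coeff (Ψ' t ω) n) 2 P :=
        eLpNorm_congr_ae (hII.mono fun ω hω => by simp only [hω])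
      rw [e1]
      refine le_trans (le_of_eq (congrArg (fun f => eLpNorm f 2 P) ?_))
        (eLpNorm_sub_le ((hmI F).sub hm) ((hmI F).sub hm') (by norm_num))
      funext ω
      simp only [Pi.sub_apply]
      ring
    have h0 : eLpNorm (fun ω => coeff (Ψ' t ω) n - coeff (Ψ t ω) n) 2 P ≤ 0 := by
      have := ge_of_tendsto' (hlim.add hlim') hle
      rwa [add_zero] at this
    have h1 := (eLpNorm_eq_zero_iff (hm'.sub hm) (by norm_num)).mp (nonpos_iff_eq_zero.mp h0)
    filter_upwards [h1] with ω hω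
    exact sub_eq_zero.mp hω
  filter_upwards [ae_all_iff.mpr key] with ω hω
  exact FL_ext hω

lemma IsGammaRadonifying.tsum_ne_top (hp : p ≠ ∞) (hφ : IsGammaRadonifying φ) :
    ∑' n : ℤ, (‖bracket n ^ s‖ₑ * (∑' k : ℤ, ‖coeff (φ (e k)) n‖ₑ ^ 2) ^ (1 / 2 : ℝ)) ^ p.toReal
      ≠ ∞ := by
  have hp0 := toReal_pos_of_fact hp
  have h1 : ∀ n : ℤ, (∑' k : ℤ, ‖weightedCoeff s (φ (e k)) n‖ₑ ^ 2) ^ (1 / 2 : ℝ)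
      = ‖bracket n ^ s‖ₑ * (∑' k : ℤ, ‖coeff (φ (e k)) n‖ₑ ^ 2) ^ (1 / 2 : ℝ) := fun n => by
    have h2 : ∀ k, ‖weightedCoeff s (φ (e k)) n‖ₑ ^ 2
        = ‖bracket n ^ s‖ₑ ^ 2 * ‖coeff (φ (e k)) n‖ₑ ^ 2 := fun k => by
      rw [weightedCoeff, enorm_mul, mul_pow]
      congr 2
      rw [enorm_eq_iff_norm_eq, Complex.norm_real]
    simp only [h2]
    rw [ENNReal.tsum_mul_left, ENNReal.mul_rpow_of_nonneg _ _ (by norm_num),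
      ← ENNReal.rpow_natCast, ← ENNReal.rpow_mul]
    norm_num
  rw [IsGammaRadonifying, gammaNorm] at hφ
  simp only [h1] at hφ
  exact (ENNReal.rpow_lt_top_iff_of_pos (by positivity)).mp hφ |>.ne

/-- The stochastic convolution has a version with continuous paths in `𝓕L^{s,p}`. -/
theorem exists_continuous_stochasticConvolution (hβ : IsCylindricalWiener β P) (hp : p ≠ ∞)
    (hφ : IsGammaRadonifying φ) :
    ∃ Ψ : ℝ≥0 → Ω → FL s p, IsStochasticConvolution φ β P Ψ ∧
      ∀ ω, Continuous fun t => Ψ t ω := by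
  have hp0 := toReal_pos_of_fact hp
  have hw : ∀ n, 0 < bracket n ^ s := fun n => Real.rpow_pos_of_pos (bracket_pos n) s
  have hE := hφ.tsum_ne_top hp
  have hE' : ∀ n, ∑' k : ℤ, ‖coeff (φ (e k)) n‖ₑ ^ 2 ≠ ∞ := fun n h => by
    refine ENNReal.ne_top_of_tsum_ne_top hE n ?_
    rw [h, ENNReal.top_rpow_of_pos (by positivity), ENNReal.mul_top (by simpa using (hw n).ne'),
      ENNReal.top_rpow_of_pos hp0]
  choose M hM hmom using fun n => exists_mode_moments hβ n (hE' n)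
  -- `3 ≤ m` makes the chaining series converge; `p ≤ 2m` allows Jensen's inequality.
  obtain ⟨m, hm, hpm⟩ : ∃ m : ℕ, 3 ≤ m ∧ p.toReal ≤ 2 * m := by
    obtain ⟨k, hk⟩ := exists_nat_ge p.toReal
    refine ⟨k + 3, by omega, ?_⟩
    push_cast
    have : (0 : ℝ) ≤ k := Nat.cast_nonneg k
    linarith
  have hm0 : m ≠ 0 := by omega
  have hX : ∀ n t, AEStronglyMeasurable (M n t) P := fun n t => Lp.aestronglyMeasurable _
  have hgood := ae_tsum_chainEnergy_ne_top hp hm hpm hX (chaosMoment_ne_top m) hE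
    (fun n => (hmom n m hm0).1) (fun n => (hmom n m hm0).2)
  -- Off the good event the zero path is taken, so every path is continuous. The choice is made
  -- separately for each `ω`; measurability is recovered afterwards from the almost sure formula
  -- `hZM` for the coordinates.
  have hZ : ∀ ω, ∃ z : ℝ≥0 → lp (fun _ : ℤ => ℂ) p, Continuous z ∧
      ((∀ N : ℕ, ∑' n, (‖bracket n ^ s‖ₑ *
        chainEnergy (2 * m) N (fun t => M n t ω) ^ (1 / (2 * m : ℕ) : ℝ)) ^ p.toReal ≠ ∞) →
      ∀ t n, z t n = ((bracket n ^ s : ℝ) : ℂ) *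
        (propagatorSymbol t n * chainLimit (fun t => M n t ω) t)) := fun ω => by
    by_cases h : ∀ N : ℕ, ∑' n, (‖bracket n ^ s‖ₑ *
        chainEnergy (2 * m) N (fun t => M n t ω) ^ (1 / (2 * m : ℕ) : ℝ)) ^ p.toReal ≠ ∞
    · obtain ⟨z, hz, hz'⟩ := exists_continuous_path hp hw (by omega) h
      exact ⟨z, hz, fun _ => hz'⟩
    · exact ⟨0, continuous_const, fun h' => absurd h' h⟩
  choose Z hZc hZ using hZ
  have hZM : ∀ t n, ∀ᵐ ω ∂P, Z ω t n
      = ((bracket n ^ s : ℝ) : ℂ) * (propagatorSymbol t n * M n t ω) := fun t n => by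
    obtain ⟨N, hN⟩ := exists_nat_gt t
    have hfin : ∀ᵐ ω ∂P, chainEnergy (2 * m) N (fun t => M n t ω) ≠ ∞ := by
      filter_upwards [hgood] with ω hω h
      refine ENNReal.ne_top_of_tsum_ne_top (hω N) n ?_
      rw [h, ENNReal.top_rpow_of_pos (by positivity), ENNReal.mul_top (by simpa using (hw n).ne'),
        ENNReal.top_rpow_of_pos hp0]
    filter_upwards [hgood, chainLimit_ae_eq (hX n) hm0
      (ENNReal.mul_ne_top (chaosMoment_ne_top m) (ENNReal.pow_ne_top (hE' n)))
      (hmom n m hm0).2 hfin hN] with ω h1 h2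
    rw [hZ ω h1, h2]
  refine ⟨fun t ω => ofLp s (Z ω t), fun t => ⟨?_, fun n => ?_⟩,
    fun ω => isometry_ofLp.continuous.comp (hZc ω)⟩
  · refine isometry_ofLp.continuous.comp_aestronglyMeasurable (aestronglyMeasurable_lp hp fun n => ?_)
    exact ((((hX n t).const_mul _).const_mul _).congr ((hZM t n).mono fun ω hω => hω.symm))
  · obtain ⟨I, hI, hsum⟩ := hM n t
    refine ⟨fun k => I k, fun k => ?_, ?_⟩
    · simpa only [coeff_propagator] using hI k
    · have h1 := (Lp.tendsto_Lp_iff_tendsto_eLpNorm' _ _).mp hsum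
      refine h1.congr fun F => eLpNorm_congr_ae ?_
      filter_upwards [hZM t n, Lp.coeFn_smul (propagatorSymbol t n) (M n t),
        Lp.coeFn_finsetSum F I] with ω e1 e2 e3
      rw [Pi.sub_apply, e2, e3, coeff_ofLp, e1, ← mul_assoc, mul_comm ((bracket n ^ (-s) : ℝ) : ℂ),
        bracket_rpow_mul_neg, one_mul, Finset.sum_apply, Pi.smul_apply, smul_eq_mul]

end Convolution

end FourierLebesgue

end

theorem lemma3p3 {Ω : Type*} [MeasurableSpace Ω] (P : Measure Ω) [IsProbabilityMeasure P]
    (β : ℤ → ℝ≥0 → Ω → ℂ) (hβ : FourierLebesgue.IsCylindricalWiener β P)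
    (s : ℝ) (p : ℝ≥0∞) [Fact (1 ≤ p)] (hp : p ≠ ∞)
    (φ : FourierLebesgue.L2 →L[ℂ] FourierLebesgue.FL s p)
    (hφ : FourierLebesgue.IsGammaRadonifying φ) :
    ∃ Ψ : ℝ≥0 → Ω → FourierLebesgue.FL s p,
      FourierLebesgue.IsStochasticConvolution φ β P Ψ ∧
      (∀ᵐ ω ∂P, Continuous fun t => Ψ t ω) ∧
      ∀ Ψ' : ℝ≥0 → Ω → FourierLebesgue.FL s p,
        FourierLebesgue.IsStochasticConvolution φ β P Ψ' → ∀ t, Ψ' t =ᵐ[P] Ψ t := by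
  obtain ⟨Ψ, hΨ, hc⟩ := FourierLebesgue.exists_continuous_stochasticConvolution hβ hp hφ
  exact ⟨Ψ, hΨ, ae_of_all _ hc, fun Ψ' hΨ' t => hΨ.ae_eq hβ hΨ' t⟩
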